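/- **Problems.** An instance of #Monotone 2-SAT is a Boolean formula $\varphi$ in conjunctive normal form with variables $x_1,\dots,x_n$ (each of which occurs in $\varphi$) and clauses $C_1,\dots,C_m$, $m\ge 1$, where each clause is $x_u\vee x_v$ with $u\neq v$ (no negations); the output is the number of satisfying assignments. An instance of #Max Cut is a simple connected graph $G$ together with an integer $k>0$; the output is the number of cuts of $G$ of size $k$, i.e. of unordered partitions of $V(G)$ into two non-empty sets $X,Y$ such that exactly $k$ edges have one endpoint in $X$ and the other in $Y$. For counting problems, $A\propto B$ means that $A$ is solvable in polynomial time by a deterministic machine with an oracle for $B$ (polynomial-time Turing reducibility), and #P-hardness and #P-completeness refer to $\propto$. **Construction.** Given such a $\varphi$, let $M(\varphi)=(G,k)$, where $G$ has vertex set $\{x\}\cup\{x_1,\dots,x_n\}\cup\{c_{j,i}:1\le j\le m,\ 1\le i\le 6\}$, and where for each clause $C_j=x_u\vee x_v$ the graph $G$ contains the nine edges $$xc_{j,1},\ c_{j,1}c_{j,2},\ c_{j,2}x_u,\ x_uc_{j,3},\ c_{j,3}c_{j,4},\ c_{j,4}x_v,\ x_vc_{j,5},\ c_{j,5}c_{j,6},\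 c_{j,6}x$$ of a $9$-cycle (and no other edges; these cycles are pairwise edge-disjoint), and where $k=8m$. **Lemma.** (1) For every instance $\varphi$ of #Monotone 2-SAT, $M(\varphi)$ is an instance of #Max Cut, and the number of cuts of $G$ of size $k$ equals $3^{m}$ times the number of satisfying assignments of $\varphi$. (2) The map $M$ is computable in polynomial time. (3) Consequently #Monotone 2-SAT $\propto$ #Max Cut. (4) #Max Cut belongs to #P, and if #Monotone 2-SAT is #P-hard (which is a theorem of Valiant), then #Max Cut is #P-complete. -/

import Mathlib

/-! ### A machine model: programs over finitely many stacks of bits, with an oracle -/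

/-- Programs of a deterministic multi-stack machine with bits as stack symbols. A program mentions
only finitely many of the stacks `0, 1, 2, …`; every elementary instruction inspects or changes a
single top symbol, except for `query`, which is the oracle call. -/
inductive Prog : Type
  | skip : Prog
  | push (i : ℕ) (b : Bool) : Prog
  | pop (i : ℕ) : Prog
  | seq (p q : Prog) : Prog
  /-- three-way branching: stack `i` is empty, has top `false`, has top `true` -/
  | branch (i : ℕ) (pEmpty pFalse pTrue : Prog) : Prog
  /-- repeat the body as long as stack `i` is not empty -/
  | loop (i : ℕ) (body : Prog) : Prog
  /-- replace the content of stack `i` by the oracle's answer to it -/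
  | query (i : ℕ) : Prog

/-- The contents of the stacks; the head of a list is the top of the stack. -/
abbrev Store : Type := ℕ → List Bool

/-- `Exec O p s t s'`: started with the stacks `s` and with access to the oracle `O`, the program
`p` halts after exactly `t` steps with the stacks `s'`. Here `O w a` says that the oracle answers
the query `w` by `a`; a query without an answer blocks the computation. -/
inductive Exec (O : List Bool → List Bool → Prop) : Prog → Store → ℕ → Store → Prop
  | skip (s : Store) : Exec O Prog.skip s 1 s
  | push (i : ℕ) (b : Bool) (s : Store) :
      Exec O (Prog.push i b) s 1 (Function.update s i (b :: s i))
  | pop (i : ℕ) (s : Store) :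
      Exec O (Prog.pop i) s 1 (Function.update s i (s i).tail)
  | seq {p q : Prog} {s s' s'' : Store} {t t' : ℕ} :
      Exec O p s t s' → Exec O q s' t' s'' → Exec O (Prog.seq p q) s (t + t') s''
  | branchEmpty {i : ℕ} {p₀ p₁ p₂ : Prog} {s s' : Store} {t : ℕ} :
      s i = [] → Exec O p₀ s t s' → Exec O (Prog.branch i p₀ p₁ p₂) s (t + 1) s'
  | branchFalse {i : ℕ} {p₀ p₁ p₂ : Prog} {s s' : Store} {t : ℕ} :
      (s i).head? = some false → Exec O p₁ s t s' →
        Exec O (Prog.branch i p₀ p₁ p₂) s (t + 1) s'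
  | branchTrue {i : ℕ} {p₀ p₁ p₂ : Prog} {s s' : Store} {t : ℕ} :
      (s i).head? = some true → Exec O p₂ s t s' →
        Exec O (Prog.branch i p₀ p₁ p₂) s (t + 1) s'
  | loopDone {i : ℕ} {p : Prog} {s : Store} :
      s i = [] → Exec O (Prog.loop i p) s 1 s
  | loopStep {i : ℕ} {p : Prog} {s s' s'' : Store} {t t' : ℕ} :
      s i ≠ [] → Exec O p s t s' → Exec O (Prog.loop i p) s' t' s'' →
        Exec O (Prog.loop i p) s (t + t' + 1) s''
  | query {i : ℕ} {s : Store} {a : List Bool} :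
      O (s i) a → Exec O (Prog.query i) s 1 (Function.update s i a)

/-- The oracle that never answers: a program that halts with it makes no query. -/
def noOracle : List Bool → List Bool → Prop := fun _ _ => False

/-- The initial stacks for an input `x` (on stack `0`) and a second input `w` (on stack `1`). -/
def initStore (x w : List Bool) : Store :=
  fun i => if i = 0 then x else if i = 1 then w else []

/-- `f` is computable in polynomial time with respect to the given encodings of its arguments and
of its values. The output is read from stack `0`. -/
def PolyTimeComputable {α β : Type} (encα : α → List Bool) (encβ : β → List Bool)
    (f : α → β) : Prop :=
  ∃ (P : Prog) (p : Polynomial ℕ), ∀ a : α, ∃ (t : ℕ) (s : Store),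
    t ≤ p.eval (encα a).length ∧
    Exec noOracle P (initStore (encα a) []) t s ∧ s 0 = encβ (f a)

/-! ### Counting problems, polynomial-time Turing reductions, the class #P -/

/-- A counting problem: instances, encoded by distinct bit strings, and the number of solutions of
each instance. -/
structure CountingProblem where
  Instance : Type
  encode : Instance → List Bool
  encode_injective : Function.Injective encode
  count : Instance → ℕ

/-- The oracle for a counting problem: a query has to be (the code of) an instance, and the answer
is the number of its solutions, in binary. -/
def CountingProblem.oracle (B : CountingProblem) : List Bool → List Bool → Prop :=
  fun w a => ∃ y : B.Instance, B.encode y = w ∧ a = Nat.bits (B.count y)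

/-- The reducibility `A ∝ B`: with an oracle for `B`, the number of solutions of an instance of `A`
can be computed (in binary) in polynomial time. -/
def PolyTimeTuringReducible (A B : CountingProblem) : Prop :=
  ∃ (P : Prog) (p : Polynomial ℕ), ∀ x : A.Instance, ∃ (t : ℕ) (s : Store),
    t ≤ p.eval (A.encode x).length ∧
    Exec B.oracle P (initStore (A.encode x) []) t s ∧ s 0 = Nat.bits (A.count x)

/-- Membership in #P: the number of solutions of an instance `x` is the number of bit strings `w`
of length `q(|x|)` that a polynomial-time verifier `V` accepts together with `x`. -/
def InSharpP (A : CountingProblem) : Prop :=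
  ∃ (V : Prog) (p q : Polynomial ℕ) (R : A.Instance → List Bool → Bool),
    ∀ x : A.Instance,
      (∀ w : List Bool, w.length = q.eval (A.encode x).length → ∃ (t : ℕ) (s : Store),
        t ≤ p.eval (A.encode x).length ∧
        Exec noOracle V (initStore (A.encode x) w) t s ∧ s 0 = [R x w]) ∧
      A.count x =
        {w : List Bool | w.length = q.eval (A.encode x).length ∧ R x w = true}.ncard

/-- #P-hardness under polynomial-time Turing reductions. -/
def SharpPHard (B : CountingProblem) : Prop :=
  ∀ A : CountingProblem, InSharpP A → PolyTimeTuringReducible A B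

/-- #P-completeness. -/
def SharpPComplete (B : CountingProblem) : Prop :=
  InSharpP B ∧ SharpPHard B

/-! ### Self-delimiting binary encodings -/

/-- A number in binary: every binary digit is preceded by `true`; `false` ends the number. -/
def encodeNat (n : ℕ) : List Bool :=
  n.bits.flatMap (fun b => [true, b]) ++ [false]

/-- A list of pairs of numbers: every pair is preceded by `true`; `false` ends the list. -/
def encodePairs (l : List (ℕ × ℕ)) : List Bool :=
  l.flatMap (fun e => true :: (encodeNat e.1 ++ encodeNat e.2)) ++ [false]

theorem encodeBits_append_inj : ∀ (a b s t : List Bool),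
    (a.flatMap (fun b => [true, b]) ++ [false]) ++ s =
      (b.flatMap (fun b => [true, b]) ++ [false]) ++ t → a = b ∧ s = t
  | [], [], s, t, h => by simpa using h
  | [], _ :: _, s, t, h => by simp at h
  | _ :: _, [], s, t, h => by simp at h
  | x :: a, y :: b, s, t, h => by
    simp only [List.flatMap_cons, List.cons_append, List.nil_append, List.cons.injEq,
      true_and] at h
    obtain ⟨h₁, h₂⟩ := encodeBits_append_inj a b s t (by simpa using h.2)
    exact ⟨by rw [h.1, h₁], h₂⟩

theorem natBits_injective : Function.Injective Nat.bits := by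
  intro a b h
  have h' : Nat.digits 2 a = Nat.digits 2 b := by
    rw [Nat.digits_two_eq_bits, Nat.digits_two_eq_bits, h]
  exact Nat.digits_inj_iff.mp h'

theorem encodeNat_append_inj {a b : ℕ} {s t : List Bool}
    (h : encodeNat a ++ s = encodeNat b ++ t) : a = b ∧ s = t := by
  obtain ⟨h₁, h₂⟩ := encodeBits_append_inj _ _ _ _ h
  exact ⟨natBits_injective h₁, h₂⟩

theorem encodePairs_injective : Function.Injective encodePairs := by
  intro a
  induction a with
  | nil =>
    intro b h
    cases b with
    | nil => rfl
    | cons y b => simp [encodePairs] at h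
  | cons x a ih =>
    intro b h
    cases b with
    | nil => simp [encodePairs] at h
    | cons y b =>
      simp only [encodePairs, List.flatMap_cons, List.cons_append, List.append_assoc,
        List.cons.injEq, true_and] at h
      obtain ⟨h₁, h⟩ := encodeNat_append_inj h
      obtain ⟨h₂, h⟩ := encodeNat_append_inj h
      rw [ih h, Prod.ext h₁ h₂]

/-! ### #Monotone 2-SAT -/

/-- A conjunction of clauses `x_u ∨ x_v` in the variables `x_0, …, x_{n-1}`. -/
structure MonotoneFormula where
  n : ℕ
  clauses : List (Fin n × Fin n)

namespace MonotoneFormula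

/-- The formula has a clause, each clause contains two (distinct) variables, and
`x_0, …, x_{n-1}` are the variables of the formula, that is, each of them occurs in a clause. -/
structure Valid (φ : MonotoneFormula) : Prop where
  nonempty : φ.clauses ≠ []
  distinct : ∀ c ∈ φ.clauses, c.1 ≠ c.2
  occurs : ∀ i : Fin φ.n, ∃ c ∈ φ.clauses, i = c.1 ∨ i = c.2

/-- The number of satisfying assignments. -/
noncomputable def satCount (φ : MonotoneFormula) : ℕ :=
  {a : Fin φ.n → Bool | ∀ c ∈ φ.clauses, a c.1 = true ∨ a c.2 = true}.ncard

def encode (φ : MonotoneFormula) : List Bool :=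
  encodeNat φ.n ++ encodePairs (φ.clauses.map fun c => ((c.1 : ℕ), (c.2 : ℕ)))

theorem encode_injective : Function.Injective encode := by
  rintro ⟨n, l⟩ ⟨n', l'⟩ h
  obtain ⟨h₁, h₂⟩ := encodeNat_append_inj h
  dsimp only at h₁ h₂
  subst h₁
  have h₃ := encodePairs_injective h₂
  have h₄ : l = l' := by
    refine List.map_injective_iff.mpr ?_ h₃
    rintro ⟨a, b⟩ ⟨c, d⟩ h
    simpa [Fin.ext_iff] using h
  rw [h₄]

end MonotoneFormula

/-- #Monotone 2-SAT. -/
noncomputable def sharpMonotone2SAT : CountingProblem where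
  Instance := {φ : MonotoneFormula // φ.Valid}
  encode φ := φ.1.encode
  encode_injective := MonotoneFormula.encode_injective.comp Subtype.val_injective
  count φ := φ.1.satCount

/-! ### #Max Cut -/

namespace SimpleGraph

/-- `δ(X, Y)`: the edges of `G` with one endpoint in `X` and the other in `Y`. -/
def crossingSet {V : Type*} (G : SimpleGraph V) (X Y : Set V) : Set (Sym2 V) :=
  {e | e ∈ G.edgeSet ∧ ∃ a ∈ X, ∃ b ∈ Y, e = s(a, b)}

/-- The cuts of `G` of size `k`: the (unordered) partitions of the vertex set into two non-empty
shores whose crossing set has `k` elements. -/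
def cutsOfSize {V : Type*} (G : SimpleGraph V) (k : ℕ) : Set (Sym2 (Set V)) :=
  {C | ∃ X Y : Set V, C = s(X, Y) ∧ X.Nonempty ∧ Y.Nonempty ∧ Disjoint X Y ∧
    X ∪ Y = Set.univ ∧ (G.crossingSet X Y).ncard = k}

end SimpleGraph

/-- A graph with the vertices `0, …, n-1`, given by a list of its edges, and a number `k`. -/
structure GraphWithNumber where
  n : ℕ
  edges : List (ℕ × ℕ)
  k : ℕ

namespace GraphWithNumber

/-- The graph with the listed edges. -/
def graph (I : GraphWithNumber) : SimpleGraph (Fin I.n) :=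
  SimpleGraph.fromRel fun a b => ((a : ℕ), (b : ℕ)) ∈ I.edges

/-- The list is the edge list of a simple connected graph on `0, …, n-1` (the endpoints are
vertices, there are no loops, no edge is listed twice in either orientation), and `k` is strictly
positive. -/
structure Valid (I : GraphWithNumber) : Prop where
  vertices : ∀ e ∈ I.edges, e.1 < I.n ∧ e.2 < I.n
  loopless : ∀ e ∈ I.edges, e.1 ≠ e.2
  nodup : (I.edges.map fun e => s(e.1, e.2)).Nodup
  connected : I.graph.Connected
  pos : 0 < I.k

/-- The number of cuts of size `k`. -/
noncomputable def cutCount (I : GraphWithNumber) : ℕ :=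
  (I.graph.cutsOfSize I.k).ncard

def encode (I : GraphWithNumber) : List Bool :=
  encodeNat I.n ++ (encodeNat I.k ++ encodePairs I.edges)

theorem encode_injective : Function.Injective encode := by
  rintro ⟨n, l, k⟩ ⟨n', l', k'⟩ h
  obtain ⟨h₁, h⟩ := encodeNat_append_inj h
  obtain ⟨h₂, h⟩ := encodeNat_append_inj h
  have h₃ := encodePairs_injective h
  dsimp only at h₁ h₂ h₃
  rw [h₁, h₂, h₃]

end GraphWithNumber

/-- #Max Cut. -/
noncomputable def sharpMaxCut : CountingProblem where
  Instance := {I : GraphWithNumber // I.Valid}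
  encode I := I.1.encode
  encode_injective := GraphWithNumber.encode_injective.comp Subtype.val_injective
  count I := I.1.cutCount

/-! ### The construction -/

namespace MonotoneFormula

/-- The vertex of the variable `x_i`. -/
def varVertex (φ : MonotoneFormula) (i : Fin φ.n) : ℕ := i

/-- The hub vertex `x`. -/
def hub (φ : MonotoneFormula) : ℕ := φ.n

/-- The vertex `c_{j,i}` of the clause with index `j = 0, 1, …`, for `i = 1, …, 6`. -/
def clauseVertex (φ : MonotoneFormula) (j i : ℕ) : ℕ := φ.n + 6 * j + i

/-- The nine edges of the circuit of the clause `c = x_u ∨ x_v` with index `j`. -/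
def clauseCircuit (φ : MonotoneFormula) (c : Fin φ.n × Fin φ.n) (j : ℕ) : List (ℕ × ℕ) :=
  [(φ.hub, φ.clauseVertex j 1), (φ.clauseVertex j 1, φ.clauseVertex j 2),
    (φ.clauseVertex j 2, φ.varVertex c.1), (φ.varVertex c.1, φ.clauseVertex j 3),
    (φ.clauseVertex j 3, φ.clauseVertex j 4), (φ.clauseVertex j 4, φ.varVertex c.2),
    (φ.varVertex c.2, φ.clauseVertex j 5), (φ.clauseVertex j 5, φ.clauseVertex j 6),
    (φ.clauseVertex j 6, φ.hub)]

/-- The pair `(G, k)`: the graph `G` on the hub, the variables and six vertices for each clause is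
the union of the circuits of the clauses, and `k` is eight times the number of clauses. -/
def toMaxCut (φ : MonotoneFormula) : GraphWithNumber where
  n := φ.n + 1 + 6 * φ.clauses.length
  edges := φ.clauses.zipIdx.flatMap fun cj => φ.clauseCircuit cj.1 cj.2
  k := 8 * φ.clauses.length

end MonotoneFormula

/-! ### Runs with a time bound -/

-- Counting. Colour the two shores of a cut with two colours. Around a closed circuit the colour
-- changes an even number of times, so a 9-cycle has at most 8 crossing edges; the circuits of the
-- clauses are edge-disjoint, so a cut has at most `8 * m` crossing edges, and it has exactly `8 *
-- m` if and only if every circuit has 8. Cuts are unordered, so the hub may be given the colour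
-- `false`; the colours of the variables then form an assignment. The hub and the two variables
-- divide a circuit into three paths of length 3. A path whose ends differ has 1 or 3 crossing
-- edges, the value 3 in one way; a path whose ends agree has 0 or 2, the value 2 in three ways. If
-- both variables are `false`, the total is at most 6; otherwise exactly one of the three paths has
-- equal ends, and 8 = 3 + 3 + 2 arises in 3 ways. Hence each satisfying assignment extends in `3 ^
-- m` ways and every other one in none (`card_circuitCrossings_eq`, `ncard_extremalColourings`,
-- `Valid.cutCount_toMaxCut`).
--
-- Machines. Explicit stack programs are analysed by composing runs with time bounds. `build` writes
-- the code of the graph; `reduce` then queries the oracle and divides the answer `m` times by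
-- three. Numbers are processed in unary, which is polynomial because every variable occurs in a
-- clause, so that all numbers involved are linear in the length of the code.
--
-- Hardness. `trans_of_clean` replaces each oracle query of a reduction to #Monotone 2-SAT by a call
-- of `reduce` on fresh stacks. Two facts make this work: `reduce` leaves its auxiliary stacks
-- empty, so that it can be called again, and oracle answers are no longer than the queries, so that
-- all stores stay of polynomial size.
--
-- Membership in #P. A witness is a colour word as long as the instance, normalised so that each cut
-- has exactly one witness; `verify` counts the crossing edges and compares the result with `k`.

infixr:65 " ;; " => Prog.seq

/-- The program halts within `B` steps in the store `s'`. -/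
def Run (O : List Bool → List Bool → Prop) (p : Prog) (s : Store) (B : ℕ) (s' : Store) : Prop :=
  ∃ t ≤ B, Exec O p s t s'

namespace Run

variable {O : List Bool → List Bool → Prop} {p q r : Prog} {s s' s'' : Store} {B B' : ℕ} {i : ℕ}

theorem mono (h : Run O p s B s') (hB : B ≤ B') : Run O p s B' s' :=
  let ⟨t, ht, e⟩ := h
  ⟨t, ht.trans hB, e⟩

theorem of_eq {s₁ s₂ : Store} (h : Run O p s₁ B s₂) (h₁ : s = s₁) (h₂ : s' = s₂) (hB : B ≤ B') :
    Run O p s B' s' := by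
  subst h₁ h₂
  exact h.mono hB

theorem seq (h : Run O p s B s') (h' : Run O q s' B' s'') : Run O (p ;; q) s (B + B') s'' :=
  let ⟨_, ht, e⟩ := h
  let ⟨_, ht', e'⟩ := h'
  ⟨_, Nat.add_le_add ht ht', e.seq e'⟩

theorem loopDone (h : s i = []) : Run O (Prog.loop i p) s 1 s :=
  ⟨1, le_rfl, Exec.loopDone h⟩

theorem loopStep (hs : s i ≠ []) (h : Run O p s B s') (h' : Run O (Prog.loop i p) s' B' s'') :
    Run O (Prog.loop i p) s (B + B' + 1) s'' :=
  let ⟨_, ht, e⟩ := h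
  let ⟨_, ht', e'⟩ := h'
  ⟨_, Nat.add_le_add_right (Nat.add_le_add ht ht') 1, Exec.loopStep hs e e'⟩

theorem branchEmpty (hs : s i = []) (h : Run O p s B s') :
    Run O (Prog.branch i p q r) s (B + 1) s' :=
  let ⟨_, ht, e⟩ := h
  ⟨_, Nat.add_le_add_right ht 1, Exec.branchEmpty hs e⟩

theorem branchFalse (hs : (s i).head? = some false) (h : Run O q s B s') :
    Run O (Prog.branch i p q r) s (B + 1) s' :=
  let ⟨_, ht, e⟩ := h
  ⟨_, Nat.add_le_add_right ht 1, Exec.branchFalse hs e⟩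

theorem branchTrue (hs : (s i).head? = some true) (h : Run O r s B s') :
    Run O (Prog.branch i p q r) s (B + 1) s' :=
  let ⟨_, ht, e⟩ := h
  ⟨_, Nat.add_le_add_right ht 1, Exec.branchTrue hs e⟩

end Run

/-- Move the content of stack `i` to stack `j`, symbol by symbol. -/
def Prog.move (i j : ℕ) : Prog :=
  .loop i (.branch i .skip (.pop i ;; .push j false) (.pop i ;; .push j true))

/-- Empty stack `i`. -/
def Prog.clear (i : ℕ) : Prog := .loop i (.pop i)

/-- Add the unary number on stack `i` to the one on stack `j`, using the scratch stack `v`. -/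
def Prog.copyUnary (i j v : ℕ) : Prog :=
  .move i v ;; .loop v (.pop v ;; .push i true ;; .push j true)

/-- Unary numbers. -/
abbrev unary (n : ℕ) : List Bool := List.replicate n true

/-! ### Correctness and running times of the stack primitives. -/

section Store

variable {O : List Bool → List Bool → Prop}

open Function (update)

/-- A symbol costs one loop step, one branch step, a pop and a push. The word arrives reversed: the
programs below either use this to turn a word around or cancel it by a second move. -/
theorem Run.move {i j : ℕ} (hij : i ≠ j) (l : List Bool) : ∀ s : Store, s i = l →
    Run O (.move i j) s (4 * l.length + 1) (update (update s i []) j (l.reverse ++ s j)) := by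
  induction l with
  | nil =>
    intro s hs
    have : update (update s i []) j (([] : List Bool).reverse ++ s j) = s := by
      funext k
      simp only [Function.update_apply]
      split_ifs <;> simp_all
    rw [this]
    exact Run.loopDone hs
  | cons b l ih =>
    intro s hs
    have e : Run O (.branch i .skip (.pop i ;; .push j false) (.pop i ;; .push j true)) s 3
        (update (update s i l) j (b :: s j)) := by
      have h₁ : Exec O (.pop i ;; .push j b) s 2 (update (update s i l) j (b :: s j)) := by
        have := (Exec.pop (O := O) i s).seq (Exec.push j b _)
        rwa [Function.update_of_ne hij.symm, hs] at this
      cases b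
      · exact Run.branchFalse (by simp [hs]) ⟨2, le_rfl, h₁⟩
      · exact Run.branchTrue (by simp [hs]) ⟨2, le_rfl, h₁⟩
    have h := Run.loopStep (by simp [hs]) e
      (ih _ (by rw [Function.update_of_ne hij, Function.update_self]))
    have h₂ : update (update (update (update s i l) j (b :: s j)) i []) j
        (l.reverse ++ update (update s i l) j (b :: s j) j) =
        update (update s i []) j ((b :: l).reverse ++ s j) := by
      funext k
      simp only [Function.update_apply]
      split_ifs <;> simp
    rw [h₂] at h
    exact h.mono (by simp; omega)

theorem Run.clear {i : ℕ} (l : List Bool) : ∀ s : Store, s i = l →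
    Run O (.clear i) s (2 * l.length + 1) (update s i []) := by
  induction l with
  | nil =>
    intro s hs
    rw [← hs, Function.update_eq_self, hs]
    exact Run.loopDone hs
  | cons b l ih =>
    intro s hs
    have h := Run.loopStep (i := i) (by simp [hs]) ⟨1, le_rfl, Exec.pop (O := O) i s⟩
      (ih _ (by rw [Function.update_self, hs]; rfl))
    rw [Function.update_idem] at h
    exact h.mono (by simp; omega)

/-- The source is restored while the copy is made; the reversal by `move` is invisible on unary
words. -/
theorem Run.copyUnary {i j v : ℕ} (hij : i ≠ j) (hiv : i ≠ v) (hjv : j ≠ v) (n : ℕ) (s : Store)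
    (hi : s i = unary n) (hv : s v = []) :
    Run O (.copyUnary i j v) s (8 * n + 2) (update s j (unary n ++ s j)) := by
  have key : ∀ (m : ℕ) (s : Store), s v = unary m →
      Run O (.loop v (.pop v ;; .push i true ;; .push j true)) s (4 * m + 1)
        (update (update (update s v []) i (unary m ++ s i)) j (unary m ++ s j)) := by
    intro m
    induction m with
    | zero =>
      intro s hs
      have : update (update (update s v []) i (unary 0 ++ s i)) j (unary 0 ++ s j) = s := by
        funext k
        simp only [Function.update_apply]
        split_ifs <;> simp_all
      rw [this]
      exact Run.loopDone hs
    | succ m ih =>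
      intro s hs
      have h := Run.loopStep (i := v) (by simp [hs, unary])
        ⟨_, le_rfl, (Exec.pop (O := O) v s).seq ((Exec.push i true _).seq (Exec.push j true _))⟩
        (ih _ (by simp [Function.update_apply, hiv.symm, hjv.symm, hs, List.replicate_succ]))
      refine (?_ : Run O _ s _ _).mono (?_ : 3 + (4 * m + 1) + 1 ≤ _)
      · convert h using 1
        funext k
        simp only [Function.update_apply]
        split_ifs <;> simp_all [List.replicate_succ']
      · omega
  have h := (Run.move hiv _ s hi).seq (key n _ (by simp [hv]))
  refine (?_ : Run O _ s _ _).mono (?_ : 4 * n + 1 + (4 * n + 1) ≤ _)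
  · convert h using 1
    · rfl
    · simp
    · funext k
      simp only [Function.update_apply]
      split_ifs <;> simp_all
  · omega

end Store

/-! ### States: the contents of the fourteen stacks that the programs below use -/

/-- With a record in place of a function on `ℕ`, changes of different stacks commute definitionally,
so that runs of concrete loop-free programs can be checked by `rfl`. -/
structure St where
  inp : List Bool
  wit : List Bool
  a : List Bool
  b : List Bool
  c : List Bool
  out : List Bool
  dig : List Bool
  un : List Bool
  tmp : List Bool
  x : List Bool
  y : List Bool
  flg : List Bool
  bit : List Bool
  bad : List Bool

namespace St

def get (s : St) : ℕ → List Bool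
  | 0 => s.inp
  | 1 => s.wit
  | 2 => s.a
  | 3 => s.b
  | 4 => s.c
  | 5 => s.out
  | 6 => s.dig
  | 7 => s.un
  | 8 => s.tmp
  | 9 => s.x
  | 10 => s.y
  | 11 => s.flg
  | 12 => s.bit
  | 13 => s.bad
  | _ => []

def set (s : St) (i : ℕ) (l : List Bool) : St :=
  match i with
  | 0 => { s with inp := l }
  | 1 => { s with wit := l }
  | 2 => { s with a := l }
  | 3 => { s with b := l }
  | 4 => { s with c := l }
  | 5 => { s with out := l }
  | 6 => { s with dig := l }
  | 7 => { s with un := l }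
  | 8 => { s with tmp := l }
  | 9 => { s with x := l }
  | 10 => { s with y := l }
  | 11 => { s with flg := l }
  | 12 => { s with bit := l }
  | 13 => { s with bad := l }
  | _ => s

/-- The store with this content of the stacks `0, …, 13`; the other stacks are empty. -/
abbrev toStore (s : St) : Store := s.get

theorem toStore_set (s : St) {i : ℕ} (hi : i < 14) (l : List Bool) :
    (s.set i l).toStore = Function.update s.toStore i l := by
  funext k
  by_cases hk : k < 14
  · interval_cases i <;> interval_cases k <;> rfl
  · obtain ⟨k, rfl⟩ := Nat.exists_eq_add_of_le' (not_lt.mp hk)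
    rw [Function.update_of_ne (by omega)]
    rfl

/-- The initial state. -/
abbrev init (x w : List Bool) : St := ⟨x, w, [], [], [], [], [], [], [], [], [], [], [], []⟩

theorem toStore_init (x w : List Bool) : (init x w).toStore = initStore x w := by
  funext k
  match k with
  | 0 => rfl
  | 1 => rfl
  | 2 | 3 | 4 | 5 | 6 | 7 | 8 | 9 | 10 | 11 | 12 | 13 => rfl
  | _ + 14 => rfl

end St

/-- The effect and the running time of a program without loops and queries. -/
def Prog.eval : Prog → St → Option (ℕ × St)
  | .skip, s => some (1, s)
  | .push i b, s => if i < 14 then some (1, s.set i (b :: s.get i)) else none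
  | .pop i, s => if i < 14 then some (1, s.set i (s.get i).tail) else none
  | .seq p q, s => (p.eval s).bind fun u => (q.eval u.2).map fun v => (u.1 + v.1, v.2)
  | .branch i p q r, s =>
    match s.get i with
    | [] => (p.eval s).map fun u => (u.1 + 1, u.2)
    | false :: _ => (q.eval s).map fun u => (u.1 + 1, u.2)
    | true :: _ => (r.eval s).map fun u => (u.1 + 1, u.2)
  | .loop _ _, _ => none
  | .query _, _ => none

/-- Reflection: evaluating the interpreter `Prog.eval` replaces building a derivation of `Exec` by
hand. -/
theorem Prog.exec_of_eval (O : List Bool → List Bool → Prop) (p : Prog) :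
    ∀ (s s' : St) (t : ℕ), p.eval s = some (t, s') → Exec O p s.toStore t s'.toStore := by
  induction p with
  | skip =>
    intro s s' t h
    simp only [Prog.eval, Option.some.injEq, Prod.mk.injEq] at h
    obtain ⟨rfl, rfl⟩ := h
    exact Exec.skip _
  | push i b =>
    intro s s' t h
    simp only [Prog.eval, Option.ite_none_right_eq_some, Option.some.injEq, Prod.mk.injEq] at h
    obtain ⟨hi, rfl, rfl⟩ := h
    rw [St.toStore_set _ hi]
    exact Exec.push i b _
  | pop i =>
    intro s s' t h
    simp only [Prog.eval, Option.ite_none_right_eq_some, Option.some.injEq, Prod.mk.injEq] at h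
    obtain ⟨hi, rfl, rfl⟩ := h
    rw [St.toStore_set _ hi]
    exact Exec.pop i _
  | seq p q ihp ihq =>
    intro s s' t h
    simp only [Prog.eval, Option.bind_eq_some_iff, Option.map_eq_some_iff, Prod.mk.injEq] at h
    obtain ⟨⟨t₁, s₁⟩, h₁, ⟨t₂, s₂⟩, h₂, rfl, rfl⟩ := h
    exact (ihp _ _ _ h₁).seq (ihq _ _ _ h₂)
  | branch i p q r ihp ihq ihr =>
    intro s s' t h
    simp only [Prog.eval] at h
    split at h <;> rename_i hs <;>
      simp only [Option.map_eq_some_iff, Prod.mk.injEq] at h <;>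
      obtain ⟨⟨t₁, s₁⟩, h₁, rfl, rfl⟩ := h
    · exact Exec.branchEmpty hs (ihp _ _ _ h₁)
    · exact Exec.branchFalse (by simp [hs]) (ihq _ _ _ h₁)
    · exact Exec.branchTrue (by simp [hs]) (ihr _ _ _ h₁)
  | loop i p ih => intro s s' t h; simp [Prog.eval] at h
  | query i => intro s s' t h; simp [Prog.eval] at h

section State

variable {O : List Bool → List Bool → Prop}

theorem Run.eval (p : Prog) (s s' : St) (t : ℕ) (h : p.eval s = some (t, s')) :
    Run O p s.toStore t s'.toStore :=
  ⟨t, le_rfl, Prog.exec_of_eval O p _ _ _ h⟩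

theorem St.move (s : St) (i j : ℕ) (hi : i < 14 := by decide) (hj : j < 14 := by decide)
    (hij : i ≠ j := by decide) :
    Run O (.move i j) s.toStore (4 * (s.get i).length + 1)
      ((s.set i []).set j ((s.get i).reverse ++ s.get j)).toStore := by
  rw [St.toStore_set _ hj, St.toStore_set _ hi]
  exact Run.move hij _ _ rfl

theorem St.clear (s : St) (i : ℕ) (hi : i < 14 := by decide) :
    Run O (.clear i) s.toStore (2 * (s.get i).length + 1) (s.set i []).toStore := by
  rw [St.toStore_set _ hi]
  exact Run.clear _ _ rfl

theorem St.copyUnary (s : St) (i j v n : ℕ) (hsi : s.get i = unary n) (hsv : s.get v = [])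
    (hj : j < 14 := by decide) (hij : i ≠ j := by decide) (hiv : i ≠ v := by decide)
    (hjv : j ≠ v := by decide) :
    Run O (.copyUnary i j v) s.toStore (8 * n + 2) (s.set j (unary n ++ s.get j)).toStore := by
  rw [St.toStore_set _ hj]
  exact Run.copyUnary hij hiv hjv n _ hsi hsv

end State

/-! ### Numbers: from binary to unary and back -/

section Numbers

variable {O : List Bool → List Bool → Prop}

/-- The self-delimiting code of a list of bits. -/
abbrev encodeBits (l : List Bool) : List Bool := l.flatMap (fun b => [true, b]) ++ [false]

/-- Read a bit, or the end marker, of the code of a list of bits. -/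
def readBit : Prog :=
  .branch 0 (.pop 11) (.pop 0 ;; .pop 11)
    (.pop 0 ;; .branch 0 .skip (.pop 0 ;; .push 6 false) (.pop 0 ;; .push 6 true))

/-- Read the code of a list of bits from stack `0` and push the bits to stack `6`. -/
def readBits : Prog :=
  .push 11 true ;; .loop 11 readBit

/-- Stack `11` is a loop flag: its single symbol is popped at the end marker. Codes list the least
significant bit first, so the most significant one ends on top, as `horner` needs it. -/
theorem readBits_run (l rest : List Bool) (s : St) :
    Run O readBits { s with inp := encodeBits l ++ rest, flg := [] }.toStore (6 * l.length + 6)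
      { s with inp := rest, dig := l.reverse ++ s.dig, flg := [] }.toStore := by
  have key : ∀ (l : List Bool) (s : St), Run O (.loop 11 readBit)
      { s with inp := encodeBits l ++ rest, flg := [true] }.toStore (6 * l.length + 5)
      { s with inp := rest, dig := l.reverse ++ s.dig, flg := [] }.toStore := by
    intro l
    induction l with
    | nil =>
      intro s
      have h := Run.eval (O := O) readBit { s with inp := false :: rest, flg := [true] }
        { s with inp := rest, flg := [] } 3 rfl
      exact (Run.loopStep (List.cons_ne_nil _ _) h (Run.loopDone rfl)).mono (by simp)
    | cons b l ih =>
      intro s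
      have h := Run.eval (O := O) readBit
        { s with inp := true :: b :: (encodeBits l ++ rest), flg := [true] }
        { s with inp := encodeBits l ++ rest, dig := b :: s.dig, flg := [true] } 5
        (by cases b <;> rfl)
      rw [List.reverse_cons, List.append_assoc l.reverse]
      refine (Run.loopStep (List.cons_ne_nil _ _) h (ih { s with dig := b :: s.dig })).mono ?_
      rw [List.length_cons]
      omega
  exact ((Run.eval _ { s with inp := encodeBits l ++ rest, flg := [] } _ 1 rfl).seq
    (key l s)).mono (by omega)

/-- Horner's rule: add the binary number on stack `6` (most significant bit on top) to the
suitably shifted unary number on stack `7`. -/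
def horner : Prog :=
  .loop 6 (.loop 7 (.pop 7 ;; .push 8 true ;; .push 8 true) ;; .move 8 7 ;;
    .branch 6 .skip (.pop 6) (.pop 6 ;; .push 7 true))

/-- The value of a list of bits, most significant bit first, started from the value `u`. -/
def hornerValue (u : ℕ) (l : List Bool) : ℕ := l.foldl (fun a b => 2 * a + b.toNat) u

/-- A bound for the final value thus bounds all unary numbers that occur on the way. -/
theorem le_hornerValue (l : List Bool) : ∀ u, u ≤ hornerValue u l := by
  induction l with
  | nil => exact fun u => le_rfl
  | cons b l ih => exact fun u => le_trans (by omega) (ih (2 * u + b.toNat))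

theorem hornerValue_bits (n : ℕ) : hornerValue 0 n.bits.reverse = n := by
  induction n using Nat.binaryRec' with
  | zero => rfl
  | bit b n h ih =>
    rw [Nat.bits_append_bit n b h, List.reverse_cons]
    rw [hornerValue] at ih ⊢
    rw [List.foldl_append, ih, Nat.bit_val]
    rfl

theorem double_run (n : ℕ) : ∀ (v : ℕ) (s : St),
    Run O (.loop 7 (.pop 7 ;; .push 8 true ;; .push 8 true))
      { s with un := unary n, tmp := unary v }.toStore (4 * n + 1)
      { s with un := [], tmp := unary (2 * n + v) }.toStore := by
  induction n with
  | zero => intro v s; simpa using Run.loopDone rfl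
  | succ n ih =>
    intro v s
    have h := Run.eval (O := O) (.pop 7 ;; .push 8 true ;; .push 8 true)
      { s with un := unary (n + 1), tmp := unary v }
      { s with un := unary n, tmp := unary (v + 2) } 3 rfl
    rw [show 2 * (n + 1) + v = 2 * n + (v + 2) by ring]
    exact (Run.loopStep (List.cons_ne_nil _ _) h (ih (v + 2) s)).mono (by omega)

/-- One digit costs at most `4 * u + 1` for doubling, `8 * u + 1` for moving back, 3 for the digit
and 1 for the loop. -/
theorem horner_run (l : List Bool) (N : ℕ) : ∀ (u : ℕ) (s : St), hornerValue u l ≤ N →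
    Run O horner { s with dig := l, un := unary u, tmp := [] }.toStore
      (l.length * (12 * N + 6) + 1)
      { s with dig := [], un := unary (hornerValue u l), tmp := [] }.toStore := by
  induction l with
  | nil => intro u s h; exact (Run.loopDone rfl).mono (by simp)
  | cons b l ih =>
    intro u s h
    have hu := (le_hornerValue _ _).trans h
    have h₁ := double_run (O := O) u 0 { s with dig := b :: l }
    have h₂ := St.move (O := O) { s with dig := b :: l, un := [], tmp := unary (2 * u) } 8 7
    have h₃ := Run.eval (O := O) (.branch 6 .skip (.pop 6) (.pop 6 ;; .push 7 true))
      { s with dig := b :: l, un := unary (2 * u), tmp := [] }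
      { s with dig := l, un := unary (2 * u + b.toNat), tmp := [] } (2 + b.toNat)
      (by cases b <;> rfl)
    simp only [St.get, St.set, List.reverse_replicate, List.append_nil,
      List.length_replicate] at h₂
    have h₄ := Run.loopStep (i := 6) (List.cons_ne_nil _ _) (h₁.seq (h₂.seq h₃))
      (ih (2 * u + b.toNat) s h)
    refine h₄.mono ?_
    have := Bool.toNat_le b
    rw [List.length_cons, add_mul]
    omega

/-- Read a binary number from stack `0` and put it in unary on stack `7`. -/
def readNum : Prog := readBits ;; horner

theorem length_bits_le (n : ℕ) : n.bits.length ≤ n := by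
  rw [Nat.size_eq_bits_len]
  exact Nat.size_le.mpr Nat.lt_two_pow_self

/-- Unary expansion can be exponential in the length of a binary code; the bound is in terms of `L`,
which is later chosen linear in the length of the whole instance. -/
theorem readNum_run (n L : ℕ) (hL : n ≤ L) (rest : List Bool) (s : St) :
    Run O readNum
      { s with inp := encodeNat n ++ rest, dig := [], un := [], tmp := [], flg := [] }.toStore
      (12 * (L + 1) ^ 2)
      { s with inp := rest, dig := [], un := unary n, tmp := [], flg := [] }.toStore := by
  have h₁ := readBits_run (O := O) n.bits rest { s with dig := [], un := [], tmp := [], flg := [] }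
  have h₂ := horner_run (O := O) n.bits.reverse n 0
    { s with inp := rest, flg := [] } (hornerValue_bits n).le
  rw [hornerValue_bits] at h₂
  simp only [List.append_nil] at h₁
  refine (h₁.seq h₂).mono ?_
  rw [List.length_reverse]
  have := (length_bits_le n).trans hL
  nlinarith [Nat.mul_le_mul this hL]

def halveStep : Prog :=
  .pop 7 ;; .branch 7 (.push 12 true) (.pop 7 ;; .push 8 true) (.pop 7 ;; .push 8 true)

/-- Halve the unary number on stack `7`: the quotient goes to stack `8`, and a symbol on stack `12`
indicates that the remainder is one. -/
def halve : Prog := .loop 7 halveStep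

theorem halve_run (n : ℕ) : ∀ (v : ℕ) (s : St),
    Run O halve { s with un := unary n, tmp := unary v, bit := [] }.toStore (5 * n + 1)
      { s with un := [], tmp := unary (n / 2 + v), bit := unary (n % 2) }.toStore := by
  induction n using Nat.strong_induction_on with
  | _ n ih =>
    intro v s
    match n with
    | 0 => simpa [halve] using Run.loopDone (p := halveStep) rfl
    | 1 =>
      have h := Run.eval (O := O) halveStep { s with un := unary 1, tmp := unary v, bit := [] }
        { s with un := [], tmp := unary v, bit := [true] } 3 rfl
      rw [show 1 / 2 + v = v by omega]
      exact (Run.loopStep (List.cons_ne_nil _ _) h (Run.loopDone rfl)).mono (by omega)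
    | n + 2 =>
      have h := Run.eval (O := O) halveStep
        { s with un := unary (n + 2), tmp := unary v, bit := [] }
        { s with un := unary n, tmp := unary (v + 1), bit := [] } 4 rfl
      rw [show (n + 2) / 2 + v = n / 2 + (v + 1) by omega, show (n + 2) % 2 = n % 2 by omega]
      exact (Run.loopStep (List.cons_ne_nil _ _) h (ih n (by omega) (v + 1) s)).mono (by omega)

/-- Write the binary code of the unary number on stack `7` to stack `5`, first symbol first. -/
def emit : Prog :=
  .loop 7 (halve ;; .push 5 true ;;
    .branch 12 (.push 5 false) (.pop 12 ;; .push 5 true) (.pop 12 ;; .push 5 true) ;;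
    .move 8 7) ;;
  .push 5 false

theorem bits_eq_cons {n : ℕ} (hn : n ≠ 0) :
    n.bits = decide (n % 2 = 1) :: (n / 2).bits := by
  rcases Nat.even_or_odd' n with ⟨k, rfl | rfl⟩
  · rw [Nat.bit0_bits k (by omega)]
    simp
  · rw [Nat.bit1_bits k]
    congr 2
    · simp
    · omega

/-- Halving yields the bits from the least significant one on, which is the order of the code. On
stack `5` the code lies reversed, and a final `move` will turn it around. -/
theorem emit_run (n L : ℕ) (hL : n ≤ L) (s : St) :
    Run O emit { s with un := unary n, tmp := [], bit := [] }.toStore (9 * (L + 1) ^ 2)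
      { s with un := [], tmp := [], bit := [], out := (encodeNat n).reverse ++ s.out }.toStore := by
  have key : ∀ (n : ℕ) (s : St), n ≤ L → Run O
      (.loop 7 (halve ;; .push 5 true ;;
        .branch 12 (.push 5 false) (.pop 12 ;; .push 5 true) (.pop 12 ;; .push 5 true) ;;
        .move 8 7))
      { s with un := unary n, tmp := [], bit := [] }.toStore (n * (7 * L + 8) + 1)
      { s with un := [], tmp := [], bit := [],
               out := (n.bits.flatMap fun b => [true, b]).reverse ++ s.out }.toStore := by
    intro n
    induction n using Nat.strong_induction_on with
    | _ n ih =>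
      intro s hL
      rcases eq_or_ne n 0 with rfl | hn
      · simpa using Run.loopDone rfl
      have h₁ := halve_run (O := O) n 0 s
      set o : List Bool := decide (n % 2 = 1) :: true :: s.out with ho
      have h₂ := Run.eval (O := O) (.push 5 true)
        { s with un := [], tmp := unary (n / 2), bit := unary (n % 2) }
        { s with un := [], tmp := unary (n / 2), bit := unary (n % 2), out := true :: s.out } 1 rfl
      have h₃ := Run.eval (O := O)
        (.branch 12 (.push 5 false) (.pop 12 ;; .push 5 true) (.pop 12 ;; .push 5 true))
        { s with un := [], tmp := unary (n / 2), bit := unary (n % 2), out := true :: s.out }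
        { s with un := [], tmp := unary (n / 2), bit := [], out := o } (2 + n % 2)
        (by rw [ho]; rcases Nat.mod_two_eq_zero_or_one n with h | h <;> rw [h] <;> rfl)
      have h₄ := St.move (O := O) { s with un := [], tmp := unary (n / 2), bit := [], out := o } 8 7
      simp only [St.get, St.set, List.reverse_replicate, List.append_nil,
        List.length_replicate] at h₄
      have h₅ := Run.loopStep (i := 7) (by simpa [St.get] using hn) (h₁.seq (h₂.seq (h₃.seq h₄)))
        (ih (n / 2) (by omega) { s with out := o } (by omega))
      rw [bits_eq_cons hn]
      simp only [ho, List.flatMap_cons, List.reverse_append, List.append_assoc] at h₅ ⊢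
      refine h₅.mono ?_
      -- The crude count of `n` rounds suffices: `n / 2 + 1 ≤ n` since `n ≠ 0`.
      have : (n / 2 + 1) * (7 * L + 8) ≤ n * (7 * L + 8) := Nat.mul_le_mul_right _ (by omega)
      rw [add_mul] at this
      omega
  have h := (key n s hL).seq (Run.eval (.push 5 false) _ _ 1 rfl)
  rw [encodeNat, List.reverse_append]
  refine h.mono ?_
  nlinarith [Nat.mul_le_mul_right (7 * L + 8) hL]

/-- Add `c` to the unary number on stack `7`. -/
def addConst : ℕ → Prog
  | 0 => .skip
  | c + 1 => .push 7 true ;; addConst c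

theorem addConst_run (c : ℕ) : ∀ (n : ℕ) (s : St),
    Run O (addConst c) { s with un := unary n }.toStore (c + 1)
      { s with un := unary (n + c) }.toStore := by
  induction c with
  | zero => exact fun n s => Run.eval .skip _ _ 1 rfl
  | succ c ih =>
    intro n s
    have h := Run.eval (O := O) (.push 7 true) { s with un := unary n }
      { s with un := unary (n + 1) } 1 rfl
    rw [show n + (c + 1) = n + 1 + c by ring]
    exact (h.seq (ih (n + 1) s)).mono (by omega)

/-- Write the binary code of `n + c` to stack `5`, where `n` is the unary number on stack `i`. -/
def emitPlus (i c : ℕ) : Prog := .copyUnary i 7 8 ;; addConst c ;; emit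

theorem emitPlus_run (i c n L : ℕ) (hi : i ≠ 7) (hi' : i ≠ 8) (hL : n + c ≤ L) (s : St)
    (hn : { s with un := [], tmp := [], bit := [] }.get i = unary n) :
    Run O (emitPlus i c) { s with un := [], tmp := [], bit := [] }.toStore (20 * (L + 1) ^ 2)
      { s with un := [], tmp := [], bit := [],
               out := (encodeNat (n + c)).reverse ++ s.out }.toStore := by
  have h₁ := St.copyUnary (O := O) { s with un := [], tmp := [], bit := [] } i 7 8 n hn rfl
    (by decide) hi hi'
  simp only [St.get, St.set, List.append_nil] at h₁
  have h₂ := addConst_run (O := O) c n { s with tmp := [], bit := [] }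
  refine (h₁.seq (h₂.seq (emit_run (n + c) L hL s))).mono ?_
  nlinarith

end Numbers

/-! ### A program for the construction -/

section Construction

variable {O : List Bool → List Bool → Prop}

/-- The code of a pair within a list of pairs. -/
abbrev encodePair (e : ℕ × ℕ) : List Bool := true :: (encodeNat e.1 ++ encodeNat e.2)

theorem length_encodeNat_le (n : ℕ) : (encodeNat n).length ≤ 2 * n + 1 := by
  have := length_bits_le n
  simp only [encodeNat, List.length_append, List.length_flatMap, List.length_cons,
    List.length_nil, List.map_const', List.sum_replicate, smul_eq_mul]
  omega

/-- Write to stack `5` the code of an edge; `(i, c)` stands for the vertex `n + c`, where `n` is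
the unary number on stack `i`. -/
def emitEdge (e : (ℕ × ℕ) × (ℕ × ℕ)) : Prog :=
  .push 5 true ;; emitPlus e.1.1 e.1.2 ;; emitPlus e.2.1 e.2.2

def emitEdges : List ((ℕ × ℕ) × (ℕ × ℕ)) → Prog
  | [] => .skip
  | e :: es => emitEdge e ;; emitEdges es

/-- A working state of the construction: the remaining input, the numbers `h`, `p`, `u`, `v` on the
stacks `2`, `3`, `9`, `10`, the number of clauses that have been read, and the output so far. -/
abbrev buildState (inp : List Bool) (h p m : ℕ) (out : List Bool) (u v : ℕ) : St :=
  ⟨inp, [], unary h, unary p, unary m, out, [], [], [], unary u, unary v, [], [], []⟩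

/-- The number on a source stack. -/
def sourceValue (h p u v : ℕ) (i : ℕ) : ℕ :=
  if i = 2 then h else if i = 3 then p else if i = 9 then u else v

def vertexValue (h p u v : ℕ) (w : ℕ × ℕ) : ℕ := sourceValue h p u v w.1 + w.2

theorem emitVertex_run {h p u v L : ℕ} {w : ℕ × ℕ} (hw : w.1 ∈ [2, 3, 9, 10])
    (hL : vertexValue h p u v w ≤ L) (inp : List Bool) (m : ℕ) (out : List Bool) :
    Run O (emitPlus w.1 w.2) (buildState inp h p m out u v).toStore (20 * (L + 1) ^ 2)
      (buildState inp h p m ((encodeNat (vertexValue h p u v w)).reverse ++ out) u v).toStore := by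
  obtain ⟨i, c⟩ := w
  refine emitPlus_run i c (sourceValue h p u v i) L ?_ ?_ hL (buildState inp h p m out u v) ?_
  · rintro rfl; simp at hw
  · rintro rfl; simp at hw
  · simp only [List.mem_cons, List.not_mem_nil, or_false] at hw
    rcases hw with rfl | rfl | rfl | rfl <;> rfl

theorem emitEdges_run {h p u v L : ℕ} (inp : List Bool) (m : ℕ)
    (es : List ((ℕ × ℕ) × (ℕ × ℕ)))
    (hes : ∀ e ∈ es, (e.1.1 ∈ [2, 3, 9, 10] ∧ vertexValue h p u v e.1 ≤ L) ∧
      (e.2.1 ∈ [2, 3, 9, 10] ∧ vertexValue h p u v e.2 ≤ L)) : ∀ out : List Bool,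
    Run O (emitEdges es) (buildState inp h p m out u v).toStore
      (es.length * (41 * (L + 1) ^ 2) + 1)
      (buildState inp h p m
        ((es.flatMap fun e => encodePair (vertexValue h p u v e.1, vertexValue h p u v e.2)).reverse
          ++ out) u v).toStore := by
  induction es with
  | nil => exact fun out => (Run.eval .skip _ _ 1 rfl).mono (by simp)
  | cons e es ih =>
    intro out
    obtain ⟨⟨h₁, h₁'⟩, h₂, h₂'⟩ := hes e List.mem_cons_self
    have r₀ := Run.eval (O := O) (.push 5 true) (buildState inp h p m out u v)
      (buildState inp h p m (true :: out) u v) 1 rfl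
    have r := (r₀.seq ((emitVertex_run h₁ h₁' inp m _).seq (emitVertex_run h₂ h₂' inp m _))).seq
      (ih (fun e he => hes e (List.mem_cons_of_mem _ he)) _)
    refine r.of_eq rfl (by simp) ?_
    rw [List.length_cons]
    nlinarith

/-- The nine edges of the circuit of a clause; the stacks `2`, `3`, `9`, `10` hold the hub, the
last vertex before those of the clause, and the two variables. -/
def circuitSources : List ((ℕ × ℕ) × (ℕ × ℕ)) :=
  [((2, 0), (3, 1)), ((3, 1), (3, 2)), ((3, 2), (9, 0)), ((9, 0), (3, 3)), ((3, 3), (3, 4)),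
    ((3, 4), (10, 0)), ((10, 0), (3, 5)), ((3, 5), (3, 6)), ((3, 6), (2, 0))]

def circuitEdges (h p u v : ℕ) : List (ℕ × ℕ) :=
  [(h, p + 1), (p + 1, p + 2), (p + 2, u), (u, p + 3), (p + 3, p + 4), (p + 4, v), (v, p + 5),
    (p + 5, p + 6), (p + 6, h)]

theorem emitCircuit_run {h p u v L : ℕ} (hh : h ≤ L) (hp : p + 6 ≤ L) (hu : u ≤ L) (hv : v ≤ L)
    (inp : List Bool) (m : ℕ) (out : List Bool) :
    Run O (emitEdges circuitSources) (buildState inp h p m out u v).toStore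
      (370 * (L + 1) ^ 2)
      (buildState inp h p m (((circuitEdges h p u v).flatMap encodePair).reverse ++ out)
        u v).toStore := by
  have r := emitEdges_run (O := O) (h := h) (p := p) (u := u) (v := v) (L := L) inp m circuitSources
    (by
      simp only [circuitSources, vertexValue, sourceValue, List.forall_mem_cons]
      simp
      omega) out
  have e : (circuitSources.flatMap fun e =>
      encodePair (vertexValue h p u v e.1, vertexValue h p u v e.2)) =
      (circuitEdges h p u v).flatMap encodePair := rfl
  rw [e] at r
  refine r.mono ?_
  have : circuitSources.length = 9 := rfl
  rw [this]
  nlinarith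

/-- Process a clause. -/
def clauseStep : Prog :=
  .pop 0 ;; readNum ;; .move 7 9 ;; readNum ;; .move 7 10 ;; emitEdges circuitSources ;;
  .clear 9 ;; .clear 10 ;;
  .push 3 true ;; .push 3 true ;; .push 3 true ;; .push 3 true ;; .push 3 true ;; .push 3 true ;;
  .push 4 true

theorem clauseStep_run {h p u v L : ℕ} (hh : h ≤ L) (hp : p + 6 ≤ L) (hu : u ≤ L) (hv : v ≤ L)
    (rest : List Bool) (m : ℕ) (out : List Bool) :
    Run O clauseStep (buildState (encodePair (u, v) ++ rest) h p m out 0 0).toStore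
      (420 * (L + 1) ^ 2)
      (buildState rest h (p + 6) (m + 1)
        (((circuitEdges h p u v).flatMap encodePair).reverse ++ out) 0 0).toStore := by
  have r₁ := Run.eval (O := O) (.pop 0) (buildState (encodePair (u, v) ++ rest) h p m out 0 0)
    (buildState (encodeNat u ++ encodeNat v ++ rest) h p m out 0 0) 1 rfl
  rw [List.append_assoc] at r₁
  have r₂ := readNum_run (O := O) u L hu (encodeNat v ++ rest)
    (buildState (encodeNat u ++ (encodeNat v ++ rest)) h p m out 0 0)
  have r₃ := St.move (O := O) { buildState (encodeNat v ++ rest) h p m out 0 0 with un := unary u }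
    7 9
  have r₄ := readNum_run (O := O) v L hv rest
    (buildState (encodeNat v ++ rest) h p m out u 0)
  have r₅ := St.move (O := O) { buildState rest h p m out u 0 with un := unary v } 7 10
  have r₆ := emitCircuit_run (O := O) hh hp hu hv rest m out
  set o := ((circuitEdges h p u v).flatMap encodePair).reverse ++ out with ho
  have r₇ := St.clear (O := O) (buildState rest h p m o u v) 9
  have r₈ := St.clear (O := O) (buildState rest h p m o 0 v) 10
  have r₉ := Run.eval (O := O)
    (.push 3 true ;; .push 3 true ;; .push 3 true ;; .push 3 true ;; .push 3 true ;;
      .push 3 true ;; .push 4 true) (buildState rest h p m o 0 0)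
    (buildState rest h (p + 6) (m + 1) o 0 0) 7 rfl
  simp only [St.get, St.set, List.reverse_replicate, List.length_replicate,
    List.replicate_zero, List.append_nil] at r₃ r₅ r₇ r₈
  refine (r₁.seq (r₂.seq (r₃.seq (r₄.seq (r₅.seq (r₆.seq (r₇.seq (r₈.seq r₉)))))))).mono ?_
  nlinarith

/-- The edges of the circuits of a list of clauses. -/
def circuitsEdges (h : ℕ) : ℕ → List (ℕ × ℕ) → List (ℕ × ℕ)
  | _, [] => []
  | p, e :: l => circuitEdges h p e.1 e.2 ++ circuitsEdges h (p + 6) l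

/-- Process the list of clauses. -/
def clauseLoop : Prog := .loop 0 (.branch 0 .skip (.pop 0) clauseStep)

/-- The number `p` is the last vertex used so far. Its final value gives the number of vertices, and
the clause count on stack `4` gives both `k` and the exponent of three. -/
theorem clauseLoop_run {h L : ℕ} (hh : h ≤ L) (l : List (ℕ × ℕ)) :
    ∀ (p m : ℕ) (out : List Bool), p + 6 * l.length ≤ L → (∀ e ∈ l, e.1 ≤ L ∧ e.2 ≤ L) →
    Run O clauseLoop (buildState (encodePairs l) h p m out 0 0).toStore
      (l.length * (422 * (L + 1) ^ 2) + 4)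
      (buildState [] h (p + 6 * l.length) (m + l.length)
        (((circuitsEdges h p l).flatMap encodePair).reverse ++ out) 0 0).toStore := by
  induction l with
  | nil =>
    intro p m out _ _
    have r := Run.eval (O := O) (.branch 0 .skip (.pop 0) clauseStep)
      (buildState (encodePairs []) h p m out 0 0) (buildState [] h p m out 0 0) 2 rfl
    exact (Run.loopStep (List.cons_ne_nil _ _) r (Run.loopDone rfl)).mono (by simp)
  | cons e l ih =>
    intro p m out hp hl
    obtain ⟨he, hl⟩ := List.forall_mem_cons.mp hl
    rw [List.length_cons] at hp
    have r := clauseStep_run (O := O) hh (p := p) (by omega) he.1 he.2 (encodePairs l) m out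
    have r' := ih (p + 6) (m + 1) (((circuitEdges h p e.1 e.2).flatMap encodePair).reverse ++ out)
      (by omega) hl
    have r'' := Run.loopStep (i := 0) (by exact List.cons_ne_nil _ _)
      (Run.branchTrue (p := .skip) (q := .pop 0) (i := 0) rfl r) r'
    refine r''.of_eq (by simp [encodePairs]) ?_ ?_
    · rw [List.length_cons, circuitsEdges, List.flatMap_append, List.reverse_append,
        List.append_assoc, show p + 6 * (l.length + 1) = p + 6 + 6 * l.length by ring,
        show m + (l.length + 1) = m + 1 + l.length by ring]
    · rw [List.length_cons]
      nlinarith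

/-- Add `k` times the number on stack `4` to stack `7`. -/
def copies : ℕ → Prog
  | 0 => .skip
  | k + 1 => .copyUnary 4 7 8 ;; copies k

theorem copies_run (m : ℕ) (s : St) (k : ℕ) : ∀ n : ℕ,
    Run O (copies k) { s with c := unary m, un := unary n, tmp := [] }.toStore
      (k * (8 * m + 2) + 1)
      { s with c := unary m, un := unary (n + k * m), tmp := [] }.toStore := by
  induction k with
  | zero => exact fun n => by simpa [copies] using Run.eval .skip _ _ 1 rfl
  | succ k ih =>
    intro n
    have r := St.copyUnary (O := O) { s with c := unary m, un := unary n, tmp := [] } 4 7 8 m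
      rfl rfl
    simp only [St.get, St.set, unary, ← List.replicate_add] at r
    have r' := r.seq (ih (m + n))
    rw [show m + n + k * m = n + (k + 1) * m by ring] at r'
    exact r'.mono (by rw [add_mul]; omega)

/-- The program for the construction. -/
def build : Prog :=
  readNum ;; .move 7 2 ;; .copyUnary 2 3 8 ;; clauseLoop ;; .push 5 false ;; .move 5 0 ;;
  (copies 8 ;; emit ;; .move 5 0) ;; (emitPlus 3 1 ;; .move 5 0)

/-- The code that `build` produces. -/
def buildOutput (n : ℕ) (l : List (ℕ × ℕ)) : List Bool :=
  encodeNat (n + 6 * l.length + 1) ++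
    (encodeNat (8 * l.length) ++ encodePairs (circuitsEdges n n l))

theorem length_encodePair_le {L : ℕ} {e : ℕ × ℕ} (h₁ : e.1 ≤ L) (h₂ : e.2 ≤ L) :
    (encodePair e).length ≤ 4 * L + 3 := by
  have := length_encodeNat_le e.1
  have := length_encodeNat_le e.2
  simp only [List.length_cons, List.length_append]
  omega

/-- Needed because turning the output around costs time proportional to its length; `36 * L + 27` is
nine edges of length at most `4 * L + 3`. -/
theorem length_circuitsEdges_le {h L : ℕ} (hh : h ≤ L) (l : List (ℕ × ℕ)) :
    ∀ p, p + 6 * l.length ≤ L → (∀ e ∈ l, e.1 ≤ L ∧ e.2 ≤ L) →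
    ((circuitsEdges h p l).flatMap encodePair).length ≤ l.length * (36 * L + 27) := by
  induction l with
  | nil => simp [circuitsEdges]
  | cons e l ih =>
    intro p hp hl
    obtain ⟨he, hl⟩ := List.forall_mem_cons.mp hl
    rw [List.length_cons] at hp
    have h₁ := ih (p + 6) (by omega) hl
    have h₂ : ((circuitEdges h p e.1 e.2).flatMap encodePair).length ≤ 9 * (4 * L + 3) := by
      rw [List.length_flatMap]
      refine (List.sum_le_card_nsmul _ (4 * L + 3) ?_).trans ?_
      · intro k hk
        obtain ⟨e', he', rfl⟩ := List.mem_map.mp hk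
        refine length_encodePair_le ?_ ?_ <;>
        · simp only [circuitEdges, List.mem_cons, List.not_mem_nil, or_false] at he'
          rcases he' with rfl | rfl | rfl | rfl | rfl | rfl | rfl | rfl | rfl <;> simp <;> omega
      · simp [circuitEdges]
    rw [circuitsEdges, List.flatMap_append, List.length_append, List.length_cons]
    nlinarith

/-- The output is assembled back to front: each `move 5 0` puts a finished piece before what is
already on stack `0`, so the edges come first, then `k`, then the number of vertices. -/
theorem build_run {n L : ℕ} {l : List (ℕ × ℕ)} (hn : n + 8 * l.length + 1 ≤ L)
    (hl : ∀ e ∈ l, e.1 ≤ L ∧ e.2 ≤ L) :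
    Run O build (St.init (encodeNat n ++ encodePairs l) []).toStore (1000 * (L + 1) ^ 3)
      (buildState (buildOutput n l) n (n + 6 * l.length) l.length [] 0 0).toStore := by
  set m := l.length with hm
  have r₁ := readNum_run (O := O) n L (by omega) (encodePairs l)
    (St.init (encodeNat n ++ encodePairs l) [])
  have r₂ := St.move (O := O) { St.init (encodePairs l) [] with un := unary n } 7 2
  have r₃ := St.copyUnary (O := O) { St.init (encodePairs l) [] with a := unary n } 2 3 8 n rfl rfl
  have r₄ := clauseLoop_run (O := O) (h := n) (L := L) (by omega) l n 0 [] (by omega) hl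
  have hE := length_circuitsEdges_le (h := n) (L := L) (by omega) l n (by omega) hl
  set E := (circuitsEdges n n l).flatMap encodePair with hEdef
  have r₅ := Run.eval (O := O) (.push 5 false)
    (buildState [] n (n + 6 * m) (0 + m) (E.reverse ++ []) 0 0)
    (buildState [] n (n + 6 * m) (0 + m) (false :: (E.reverse ++ [])) 0 0) 1 rfl
  have r₆ := St.move (O := O)
    (buildState [] n (n + 6 * m) (0 + m) (false :: (E.reverse ++ [])) 0 0) 5 0
  have r₇ := copies_run (O := O) m (buildState (E ++ [false]) n (n + 6 * m) m [] 0 0) 8 0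
  have r₈ := emit_run (O := O) (8 * m) L (by omega)
    (buildState (E ++ [false]) n (n + 6 * m) m [] 0 0)
  have r₉ := St.move (O := O)
    (buildState (E ++ [false]) n (n + 6 * m) m ((encodeNat (8 * m)).reverse ++ []) 0 0) 5 0
  have r₁₀ := emitPlus_run (O := O) 3 1 (n + 6 * m) L (by decide) (by decide) (by omega)
    (buildState (encodeNat (8 * m) ++ (E ++ [false])) n (n + 6 * m) m [] 0 0) rfl
  have r₁₁ := St.move (O := O) (buildState (encodeNat (8 * m) ++ (E ++ [false])) n (n + 6 * m) m
    ((encodeNat (n + 6 * m + 1)).reverse ++ []) 0 0) 5 0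
  simp only [St.get, St.set, List.reverse_replicate, List.length_replicate, zero_add,
    List.replicate_zero, List.append_nil, List.reverse_cons, List.reverse_reverse,
    List.length_cons, List.length_reverse] at r₂ r₃ r₄ r₅ r₆ r₇ r₈ r₉ r₁₀ r₁₁
  have hk := length_encodeNat_le (8 * m)
  have hN := length_encodeNat_le (n + 6 * m + 1)
  refine (r₁.seq (r₂.seq (r₃.seq (r₄.seq (r₅.seq (r₆.seq
    ((r₇.seq (r₈.seq r₉)).seq (r₁₀.seq r₁₁)))))))).mono ?_
  have hE' : E.length ≤ L * (36 * L + 27) := hE.trans (Nat.mul_le_mul_right _ (by omega))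
  have hc : m * (422 * (L + 1) ^ 2) ≤ L * (422 * (L + 1) ^ 2) :=
    Nat.mul_le_mul_right _ (by omega)
  nlinarith

end Construction

/-! ### Division by three -/

section Division

variable {O : List Bool → List Bool → Prop}

/-- Append a least significant zero to the binary number on stack `0`. -/
def pushZero : Prog := .branch 0 .skip (.push 0 false) (.push 0 false)

/-- One step of long division by three: the next bit of the dividend is on stack `6`, the quotient
on stack `0`, and stack `12` holds the remainder. -/
def divStep : Prog :=
  .branch 6 .skip
    (.pop 6 ;; .branch 12 pushZero (.pop 12 ;; pushZero ;; .push 12 true)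
      (.pop 12 ;; .push 0 true ;; .push 12 false))
    (.pop 6 ;; .branch 12 (pushZero ;; .push 12 false) (.pop 12 ;; .push 0 true) (.push 0 true))

/-- The code of a remainder modulo three. -/
def remainderCode : ℕ → List Bool
  | 0 => []
  | 1 => [false]
  | _ => [true]

/-- The exceptional case is that zero has the empty code; it is the reason for the branch in
`pushZero`. -/
theorem bits_two_mul (a : ℕ) :
    (2 * a).bits = match a.bits with
      | [] => []
      | b :: l => false :: b :: l := by
  rcases eq_or_ne a 0 with rfl | ha
  · simp
  · rw [Nat.bit0_bits a ha, bits_eq_cons ha]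

theorem divStep_run (b : Bool) (l : List Bool) (a q : ℕ) (hq : q < 3) (s : St) :
    Run O divStep
      { s with inp := a.bits, dig := b :: l, bit := remainderCode q }.toStore 7
      { s with inp := ((2 * (3 * a + q) + b.toNat) / 3).bits, dig := l,
               bit := remainderCode ((2 * (3 * a + q) + b.toNat) % 3) }.toStore := by
  have hz := bits_two_mul a
  have ho := Nat.bit1_bits a
  generalize a.bits = d at hz ho
  -- The next quotient bit is 0 if `2 * q + b < 3` and 1 otherwise; `h₀` and `h₁` are the two
  -- alternatives.
  have h₀ : ∀ r < 3, 2 * (3 * a + q) + b.toNat = 3 * (2 * a) + r →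
      (2 * (3 * a + q) + b.toNat) / 3 = 2 * a ∧ (2 * (3 * a + q) + b.toNat) % 3 = r := by omega
  have h₁ : ∀ r < 3, 2 * (3 * a + q) + b.toNat = 3 * (2 * a + 1) + r →
      (2 * (3 * a + q) + b.toNat) / 3 = 2 * a + 1 ∧ (2 * (3 * a + q) + b.toNat) % 3 = r := by omega
  interval_cases q <;> cases b
  · rw [(h₀ 0 (by simp) (by simp; ring)).1, (h₀ 0 (by simp) (by simp; ring)).2, hz]
    rcases d with _ | ⟨_ | _, d⟩ <;> exact (Run.eval divStep _ _ _ rfl).mono (by simp)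
  · rw [(h₀ 1 (by simp) (by simp; ring)).1, (h₀ 1 (by simp) (by simp; ring)).2, hz]
    rcases d with _ | ⟨_ | _, d⟩ <;> exact (Run.eval divStep _ _ _ rfl).mono (by simp)
  · rw [(h₀ 2 (by simp) (by simp; ring)).1, (h₀ 2 (by simp) (by simp; ring)).2, hz]
    rcases d with _ | ⟨_ | _, d⟩ <;> exact (Run.eval divStep _ _ _ rfl).mono (by simp)
  · rw [(h₁ 0 (by simp) (by simp; ring)).1, (h₁ 0 (by simp) (by simp; ring)).2, ho]
    exact (Run.eval divStep _ _ _ rfl).mono (by simp)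
  · rw [(h₁ 1 (by simp) (by simp; ring)).1, (h₁ 1 (by simp) (by simp; ring)).2, ho]
    exact (Run.eval divStep _ _ _ rfl).mono (by simp)
  · rw [(h₁ 2 (by simp) (by simp; ring)).1, (h₁ 2 (by simp) (by simp; ring)).2, ho]
    exact (Run.eval divStep _ _ _ rfl).mono (by simp)

/-- Invariant of long division: once the leading bits with value `n` are read, the stacks hold `n /
3` and `n % 3`. -/
theorem divLoop_run (l : List Bool) : ∀ (n : ℕ) (s : St),
    Run O (.loop 6 divStep)
      { s with inp := (n / 3).bits, dig := l, bit := remainderCode (n % 3) }.toStore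
      (8 * l.length + 1)
      { s with inp := (hornerValue n l / 3).bits, dig := [],
               bit := remainderCode (hornerValue n l % 3) }.toStore := by
  induction l with
  | nil => exact fun n s => Run.loopDone rfl
  | cons b l ih =>
    intro n s
    have h := divStep_run (O := O) b l (n / 3) (n % 3) (Nat.mod_lt _ (by decide)) s
    rw [Nat.div_add_mod] at h
    refine (Run.loopStep (List.cons_ne_nil _ _) h (ih (2 * n + b.toNat) s)).mono ?_
    rw [List.length_cons]
    omega

/-- Divide the binary number on stack `0` by three. -/
def divThree : Prog := .move 0 6 ;; .loop 6 divStep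

theorem divThree_run (n : ℕ) (s : St) :
    Run O divThree { s with inp := (3 * n).bits, dig := [], bit := [] }.toStore
      (12 * (3 * n).bits.length + 2) { s with inp := n.bits, dig := [], bit := [] }.toStore := by
  have h₁ := St.move (O := O) { s with inp := (3 * n).bits, dig := [], bit := [] } 0 6
  have h₂ := divLoop_run (O := O) (3 * n).bits.reverse 0 s
  simp only [St.get, St.set, List.append_nil] at h₁
  simp only [hornerValue_bits, Nat.mul_div_cancel_left n (show 0 < 3 by decide),
    Nat.mul_mod_right, List.length_reverse, Nat.zero_div, Nat.zero_bits, Nat.zero_mod] at h₂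
  exact (h₁.seq h₂).mono (by omega)

theorem length_bits_mono {a b : ℕ} (h : a ≤ b) : a.bits.length ≤ b.bits.length := by
  rw [Nat.size_eq_bits_len, Nat.size_eq_bits_len]
  exact Nat.size_le_size h

theorem length_bits_le_of_lt {a k : ℕ} (h : a < 2 ^ k) : a.bits.length ≤ k := by
  rw [Nat.size_eq_bits_len]
  exact Nat.size_le.mpr h

/-- Divide the binary number on stack `0` by the power of three whose exponent is on stack `4`. -/
def divPowThree : Prog := .loop 4 (.pop 4 ;; divThree)

/-- The dividends do not grow, so the length of the first one bounds the cost of every round. -/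
theorem divPowThree_run (n D m : ℕ) (s : St) (hD : (3 ^ m * n).bits.length ≤ D) :
    Run O divPowThree
      { s with inp := (3 ^ m * n).bits, c := unary m, dig := [], bit := [] }.toStore
      (m * (12 * D + 4) + 1)
      { s with inp := n.bits, c := [], dig := [], bit := [] }.toStore := by
  induction m with
  | zero => rw [pow_zero, one_mul]; exact (Run.loopDone rfl).mono (by simp)
  | succ m ih =>
    have hD' : (3 ^ m * n).bits.length ≤ D :=
      (length_bits_mono (Nat.mul_le_mul_right n (Nat.pow_le_pow_right (by decide)
        m.le_succ))).trans hD
    have h₁ := Run.eval (O := O) (.pop 4)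
      { s with inp := (3 ^ (m + 1) * n).bits, c := unary (m + 1), dig := [], bit := [] }
      { s with inp := (3 ^ (m + 1) * n).bits, c := unary m, dig := [], bit := [] } 1 rfl
    have h₂ := divThree_run (O := O) (3 ^ m * n) { s with c := unary m }
    rw [← mul_assoc, ← pow_succ'] at h₂
    refine (Run.loopStep (List.cons_ne_nil _ _) (h₁.seq h₂) (ih hD')).mono ?_
    rw [add_mul]
    omega

/-- The reduction: construct the graph, ask for the number of cuts, divide by a power of three. -/
def reduce : Prog := build ;; .query 0 ;; divPowThree ;; .clear 2 ;; .clear 3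

/-- The final store is specified completely, not only on stack `0`, so that the program can serve as
a subroutine. Division uses up the counter on stack `4`; what remains of `build` is on the stacks
`2` and `3`. -/
theorem reduce_run {n N L : ℕ} {l : List (ℕ × ℕ)} (hn : n + 8 * l.length + 1 ≤ L)
    (hl : ∀ e ∈ l, e.1 ≤ L ∧ e.2 ≤ L)
    (hO : O (buildOutput n l) (3 ^ l.length * N).bits) (hN : (3 ^ l.length * N).bits.length ≤ L) :
    Run O reduce (initStore (encodeNat n ++ encodePairs l) []) (1100 * (L + 1) ^ 3)
      (initStore N.bits []) := by
  rw [← St.toStore_init, ← St.toStore_init]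
  set m := l.length with hm
  have r₁ := build_run (O := O) hn hl
  rw [← hm] at r₁
  have r₂ : Run O (.query 0) (buildState (buildOutput n l) n (n + 6 * m) m [] 0 0).toStore 1
      (buildState (3 ^ m * N).bits n (n + 6 * m) m [] 0 0).toStore := by
    refine ⟨1, le_rfl, ?_⟩
    have := Exec.query (O := O) (i := 0)
      (s := (buildState (buildOutput n l) n (n + 6 * m) m [] 0 0).toStore) hO
    rwa [← St.toStore_set _ (by decide)] at this
  have r₃ := divPowThree_run (O := O) N L m
    (buildState (3 ^ m * N).bits n (n + 6 * m) m [] 0 0) hN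
  have r₄ := St.clear (O := O) (buildState N.bits n (n + 6 * m) 0 [] 0 0) 2
  have r₅ := St.clear (O := O) (buildState N.bits 0 (n + 6 * m) 0 [] 0 0) 3
  simp only [St.get, St.set, List.length_replicate] at r₄ r₅
  refine (r₁.seq (r₂.seq (r₃.seq (r₄.seq r₅)))).mono ?_
  have : m * (12 * L + 4) ≤ L * (12 * L + 4) := Nat.mul_le_mul_right _ (by omega)
  have e₂ : L * (12 * L + 4) = 12 * L ^ 2 + 4 * L := by ring
  have e₃ : (L + 1) ^ 3 = L ^ 3 + 3 * L ^ 2 + 3 * L + 1 := by ring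
  omega

end Division

/-! ### Transitivity of the reducibility -/

namespace Prog

/-- Renumber the stacks: stack `i` becomes stack `i + b`. -/
def shift (b : ℕ) : Prog → Prog
  | skip => skip
  | push i c => push (i + b) c
  | pop i => pop (i + b)
  | seq p q => seq (p.shift b) (q.shift b)
  | branch i p q r => branch (i + b) (p.shift b) (q.shift b) (r.shift b)
  | loop i p => loop (i + b) (p.shift b)
  | query i => query (i + b)

/-- A strict bound for the stacks that a program mentions. -/
def stackBound : Prog → ℕ
  | skip => 0
  | push i _ => i + 1
  | pop i => i + 1
  | seq p q => max p.stackBound q.stackBound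
  | branch i p q r => max (i + 1) (max p.stackBound (max q.stackBound r.stackBound))
  | loop i p => max (i + 1) p.stackBound
  | query i => i + 1

/-- Call the program `Q`, whose stacks are `b`, `b + 1`, …, for the content of stack `i`. -/
def call (b : ℕ) (Q : Prog) (i : ℕ) : Prog :=
  move i (b + 1) ;; move (b + 1) b ;; Q.shift b ;; move b (b + 1) ;; move (b + 1) i

/-- Replace the oracle queries by calls of the program `Q`. -/
def substQuery (b : ℕ) : Prog → Prog → Prog
  | skip, _ => skip
  | push i c, _ => push i c
  | pop i, _ => pop i
  | seq p q, Q => seq (p.substQuery b Q) (q.substQuery b Q)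
  | branch i p q r, Q => branch i (p.substQuery b Q) (q.substQuery b Q) (r.substQuery b Q)
  | loop i p, Q => loop i (p.substQuery b Q)
  | query i, Q => call b Q i

end Prog

namespace Store

/-- The store with the stacks of `u` below `b` and those of `s` from `b` on. -/
def glue (b : ℕ) (u s : Store) : Store := fun k => if k < b then u k else s (k - b)

theorem glue_add (b : ℕ) (u s : Store) (i : ℕ) : glue b u s (i + b) = s i := by
  simp [glue]

theorem glue_of_lt {b i : ℕ} (hi : i < b) (u s : Store) : glue b u s i = u i := by
  simp [glue, hi]

theorem glue_update (b : ℕ) (u s : Store) (i : ℕ) (l : List Bool) :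
    glue b u (Function.update s i l) = Function.update (glue b u s) (i + b) l := by
  funext k
  simp only [glue, Function.update_apply]
  split_ifs <;> first | rfl | omega

theorem glue_update_of_lt {b i : ℕ} (hi : i < b) (u s : Store) (l : List Bool) :
    glue b (Function.update u i l) s = Function.update (glue b u s) i l := by
  funext k
  simp only [glue, Function.update_apply]
  split_ifs <;> first | rfl | omega

/-- The total length of the stacks below `b`. -/
def size (b : ℕ) (s : Store) : ℕ := ∑ i ∈ Finset.range b, (s i).length

theorem size_update {b i : ℕ} (hi : i < b) (s : Store) (l : List Bool) :
    size b (Function.update s i l) + (s i).length = size b s + l.length := by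
  have hi' : i ∈ Finset.range b := Finset.mem_range.mpr hi
  rw [size, size, ← Finset.add_sum_erase _ _ hi', ← Finset.add_sum_erase _ _ hi',
    Function.update_self]
  have : ∑ x ∈ (Finset.range b).erase i, (Function.update s i l x).length =
      ∑ x ∈ (Finset.range b).erase i, (s x).length :=
    Finset.sum_congr rfl fun x hx => by rw [Function.update_of_ne (Finset.ne_of_mem_erase hx)]
  omega

theorem length_le_size {b i : ℕ} (hi : i < b) (s : Store) : (s i).length ≤ size b s :=
  Finset.single_le_sum (f := fun i => (s i).length) (fun _ _ => Nat.zero_le _)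
    (Finset.mem_range.mpr hi)

end Store

/-- A shifted program never touches the stacks below `b`, whose contents `u` are therefore
arbitrary. -/
theorem Exec.shift {O : List Bool → List Bool → Prop} {p : Prog} {s s' : Store} {t : ℕ}
    (h : Exec O p s t s') (b : ℕ) (u : Store) :
    Exec O (p.shift b) (Store.glue b u s) t (Store.glue b u s') := by
  induction h with
  | skip s => exact Exec.skip _
  | push i c s =>
    rw [Store.glue_update, ← Store.glue_add b u s i]
    exact Exec.push (i + b) c _
  | pop i s =>
    rw [Store.glue_update, ← Store.glue_add b u s i]
    exact Exec.pop (i + b) _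
  | seq _ _ ih₁ ih₂ => exact ih₁.seq ih₂
  | branchEmpty h _ ih => exact Exec.branchEmpty (by rwa [Store.glue_add]) ih
  | branchFalse h _ ih => exact Exec.branchFalse (by rwa [Store.glue_add]) ih
  | branchTrue h _ ih => exact Exec.branchTrue (by rwa [Store.glue_add]) ih
  | loopDone h => exact Exec.loopDone (by rwa [Store.glue_add])
  | loopStep h _ _ ih₁ ih₂ => exact Exec.loopStep (by rwa [Store.glue_add]) ih₁ ih₂
  | query h =>
    rw [Store.glue_update]
    exact Exec.query (by rwa [Store.glue_add])

/-- Each step increases the total length of the stacks by at most one if the answers of the oracle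
are not longer than the queries. -/
theorem Exec.size_le {O : List Bool → List Bool → Prop} (hO : ∀ w a, O w a → a.length ≤ w.length)
    {p : Prog} {s s' : Store} {t : ℕ} (h : Exec O p s t s') {b : ℕ} (hp : p.stackBound ≤ b) :
    Store.size b s' ≤ Store.size b s + t := by
  induction h with
  | skip s => omega
  | push i c s =>
    have := Store.size_update (i := i) hp s (c :: s i)
    rw [List.length_cons] at this
    omega
  | pop i s =>
    have := Store.size_update (i := i) hp s (s i).tail
    rw [List.length_tail] at this
    omega
  | seq _ _ ih₁ ih₂ =>
    simp only [Prog.stackBound, max_le_iff] at hp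
    have := ih₁ hp.1
    have := ih₂ hp.2
    omega
  | branchEmpty h _ ih =>
    simp only [Prog.stackBound, max_le_iff] at hp
    have := ih hp.2.1
    omega
  | branchFalse h _ ih =>
    simp only [Prog.stackBound, max_le_iff] at hp
    have := ih hp.2.2.1
    omega
  | branchTrue h _ ih =>
    simp only [Prog.stackBound, max_le_iff] at hp
    have := ih hp.2.2.2
    omega
  | loopDone h => omega
  | loopStep h _ _ ih₁ ih₂ =>
    have := ih₁ (max_le_iff.mp hp).2
    have := ih₂ hp
    omega
  | @query i s a h =>
    have := Store.size_update (i := i) hp s a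
    have := hO _ _ h
    omega

/-- Two moves each way keep the order of the symbols; stack `b + 1` can be the intermediate one
because it is empty before and after `Q` runs. All stacks from `b` on are empty again at the end,
ready for the next call. -/
theorem Run.call {O : List Bool → List Bool → Prop} {b : ℕ} {Q : Prog} {i B : ℕ} (hi : i < b)
    {s : Store} {a : List Bool} (h : Run O Q (initStore (s i) []) B (initStore a [])) :
    Run O (Prog.call b Q i) (Store.glue b s (initStore [] []))
      (8 * (s i).length + B + 8 * a.length + 4)
      (Store.glue b (Function.update s i a) (initStore [] [])) := by
  obtain ⟨t, ht, e⟩ := h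
  have hb : ∀ l, Store.glue b (Function.update s i []) (initStore l []) =
      Function.update (Function.update (Store.glue b s (initStore [] [])) i []) b l := by
    intro l
    have : initStore l [] = Function.update (initStore [] []) 0 l := by
      funext k
      simp only [initStore, Function.update_apply]
      split_ifs <;> rfl
    rw [this, Store.glue_update, Store.glue_update_of_lt hi, zero_add]
  have g₁ : Store.glue b s (initStore [] []) b = [] := by simp [Store.glue, initStore]
  have g₂ : Store.glue b s (initStore [] []) (b + 1) = [] := by simp [Store.glue, initStore]
  have g₃ := Store.glue_of_lt hi s (initStore [] [])
  have r₁ := Run.move (O := O) (i := i) (j := b + 1) (by omega) _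
    (Store.glue b s (initStore [] [])) g₃
  have r₂ := Run.move (O := O) (i := b + 1) (j := b) (by omega) _
    (Function.update (Function.update (Store.glue b s (initStore [] [])) i []) (b + 1)
      ((s i).reverse ++ Store.glue b s (initStore [] []) (b + 1))) (Function.update_self ..)
  have r₃ : Run O (Q.shift b) _ B _ := ⟨t, ht, e.shift b (Function.update s i [])⟩
  have r₄ := Run.move (O := O) (i := b) (j := b + 1) (by omega) a
    (Store.glue b (Function.update s i []) (initStore a [])) (by simp [Store.glue, initStore])
  have r₅ := Run.move (O := O) (i := b + 1) (j := i) (by omega) _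
    (Function.update (Function.update (Store.glue b (Function.update s i [])
      (initStore a [])) b []) (b + 1)
      (a.reverse ++ Store.glue b (Function.update s i []) (initStore a []) (b + 1)))
    (Function.update_self ..)
  have hib : i ≠ b := hi.ne
  have hib' : i ≠ b + 1 := by omega
  -- The two reversals cancel, so `Q` finds exactly its initial store above `b`.
  have e₁ : Function.update (Function.update (Function.update (Function.update
      (Store.glue b s (initStore [] [])) i []) (b + 1)
      ((s i).reverse ++ Store.glue b s (initStore [] []) (b + 1))) (b + 1) []) b
      (((s i).reverse ++ Store.glue b s (initStore [] []) (b + 1)).reverse ++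
        Function.update (Function.update (Store.glue b s (initStore [] [])) i []) (b + 1)
          ((s i).reverse ++ Store.glue b s (initStore [] []) (b + 1)) b) =
      Store.glue b (Function.update s i []) (initStore (s i) []) := by
    rw [hb]
    funext k
    rcases eq_or_ne k (b + 1) with rfl | hk
    · simp [Function.update_apply, g₂, hib'.symm]
    · simp [Function.update_apply, hk, g₁, g₂, hib.symm]
  rw [e₁] at r₂
  refine (r₁.seq (r₂.seq (r₃.seq (r₄.seq r₅)))).of_eq rfl ?_ ?_
  · rw [hb, Store.glue_update_of_lt hi]
    funext k
    simp only [Function.update_apply]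
    split_ifs <;> simp_all
  · rw [hb]
    simp only [List.length_append, List.length_reverse, g₂, Function.update_apply]
    simp [hib'.symm]
    omega

/-- By `Exec.size_le` initial size plus running time bounds every stack during the run, so queries
and answers have length at most `L`. Each original step then costs at most one call: `8 * L` to pass
the query, `8 * L` for the answer, and `C` for `Q`. -/
theorem Exec.substQuery {O O' : List Bool → List Bool → Prop} {Q : Prog} {C L b : ℕ}
    (hO : ∀ w a, O w a → a.length ≤ w.length)
    (hQ : ∀ w a, O w a → w.length ≤ L → Run O' Q (initStore w []) C (initStore a []))
    {p : Prog} {s s' : Store} {t : ℕ} (h : Exec O p s t s') (hp : p.stackBound ≤ b)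
    (hL : Store.size b s + t ≤ L) :
    Run O' (p.substQuery b Q) (Store.glue b s (initStore [] [])) (t * (16 * L + C + 4))
      (Store.glue b s' (initStore [] [])) := by
  induction h with
  | skip s => exact ⟨1, by omega, Exec.skip _⟩
  | push i c s =>
    rw [Store.glue_update_of_lt hp, ← Store.glue_of_lt (i := i) hp s (initStore [] [])]
    exact ⟨1, by omega, Exec.push i c _⟩
  | pop i s =>
    rw [Store.glue_update_of_lt hp, ← Store.glue_of_lt (i := i) hp s (initStore [] [])]
    exact ⟨1, by omega, Exec.pop i _⟩
  | seq h₁ h₂ ih₁ ih₂ =>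
    simp only [Prog.stackBound, max_le_iff] at hp
    have := h₁.size_le hO hp.1
    exact ((ih₁ hp.1 (by omega)).seq (ih₂ hp.2 (by omega))).mono (by rw [add_mul])
  | branchEmpty h _ ih =>
    simp only [Prog.stackBound, max_le_iff] at hp
    exact (Run.branchEmpty (by rwa [Store.glue_of_lt hp.1]) (ih hp.2.1 (by omega))).mono
      (by rw [add_mul]; omega)
  | branchFalse h _ ih =>
    simp only [Prog.stackBound, max_le_iff] at hp
    exact (Run.branchFalse (by rwa [Store.glue_of_lt hp.1]) (ih hp.2.2.1 (by omega))).mono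
      (by rw [add_mul]; omega)
  | branchTrue h _ ih =>
    simp only [Prog.stackBound, max_le_iff] at hp
    exact (Run.branchTrue (by rwa [Store.glue_of_lt hp.1]) (ih hp.2.2.2 (by omega))).mono
      (by rw [add_mul]; omega)
  | loopDone h =>
    simp only [Prog.stackBound, max_le_iff] at hp
    exact (Run.loopDone (by rwa [Store.glue_of_lt hp.1])).mono (by omega)
  | loopStep h h₁ h₂ ih₁ ih₂ =>
    have hp' := max_le_iff.mp hp
    have := h₁.size_le hO hp'.2
    exact (Run.loopStep (by rwa [Store.glue_of_lt hp'.1]) (ih₁ hp'.2 (by omega))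
      (ih₂ hp (by omega))).mono (by rw [add_mul, add_mul]; omega)
  | @query i s a h =>
    have h₁ := Store.length_le_size (i := i) hp s
    have h₂ := hO _ _ h
    exact (Run.call hp (hQ _ _ h (by omega))).mono (by omega)

theorem Polynomial.eval_nat_mono (p : Polynomial ℕ) : Monotone fun n => p.eval n := by
  intro a b h
  simp only [Polynomial.eval_eq_sum_range]
  gcongr

/-- A reduction that empties all stacks but the one with its result can be used as a subroutine. -/
theorem PolyTimeTuringReducible.trans_of_clean {A B C : CountingProblem}
    (hAB : PolyTimeTuringReducible A B)
    (hB : ∀ y : B.Instance, (B.count y).bits.length ≤ (B.encode y).length)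
    (hBC : ∃ (Q : Prog) (q : Polynomial ℕ), ∀ y : B.Instance,
      Run C.oracle Q (initStore (B.encode y) []) (q.eval (B.encode y).length)
        (initStore (B.count y).bits [])) :
    PolyTimeTuringReducible A C := by
  obtain ⟨P, p, hP⟩ := hAB
  obtain ⟨Q, q, hQ⟩ := hBC
  -- The extra 1 makes `b` positive, so that the input and output stack `0` belongs to `P`.
  set b := P.stackBound + 1 with hb
  refine ⟨P.substQuery b Q,
    p * (16 * (Polynomial.X + p) + q.comp (Polynomial.X + p) + 4), fun x => ?_⟩
  obtain ⟨t, s, ht, e, hs⟩ := hP x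
  set ℓ := (A.encode x).length with hℓ
  have hsize : Store.size b (initStore (A.encode x) []) = ℓ := by
    rw [Store.size, hb, Finset.sum_range_succ']
    simp [initStore, hℓ]
  have hO : ∀ w a, B.oracle w a → a.length ≤ w.length := by
    rintro w a ⟨y, rfl, rfl⟩
    exact hB y
  have h := e.substQuery (b := b) (L := ℓ + p.eval ℓ) (C := q.eval (ℓ + p.eval ℓ)) (Q := Q)
    (O' := C.oracle) hO
    (by
      rintro w a ⟨y, rfl, rfl⟩ hw
      exact (hQ y).mono (q.eval_nat_mono hw)) (by omega) (by omega)
  have hinit : Store.glue b (initStore (A.encode x) []) (initStore [] []) =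
      initStore (A.encode x) [] := by
    funext k
    simp only [Store.glue, initStore]
    split_ifs <;> first | rfl | omega
  rw [hinit] at h
  obtain ⟨t', ht', e'⟩ := h
  refine ⟨t', _, ht'.trans ?_, e', ?_⟩
  · simp only [Polynomial.eval_mul, Polynomial.eval_add, Polynomial.eval_comp, Polynomial.eval_X,
      Polynomial.eval_ofNat]
    exact Nat.mul_le_mul_right _ ht
  · rw [Store.glue_of_lt (by omega), hs]

/-! ### A verifier for cuts -/

section Verifier

variable {O : List Bool → List Bool → Prop}

/-- Move as many symbols from stack `1` to stack `8` as the unary number on stack `7` says. -/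
def skipSymbols : Prog :=
  .loop 7 (.pop 7 ;; .branch 1 .skip (.pop 1 ;; .push 8 false) (.pop 1 ;; .push 8 true))

theorem skipSymbols_run (n : ℕ) : ∀ (w z : List Bool) (s : St),
    Run O skipSymbols { s with wit := w, un := unary n, tmp := z }.toStore (5 * n + 1)
      { s with wit := w.drop n, un := [], tmp := (w.take n).reverse ++ z }.toStore := by
  induction n with
  | zero => exact fun w z s => Run.loopDone rfl
  | succ n ih =>
    intro w z s
    cases w with
    | nil =>
      have h := Run.eval (O := O)
        (.pop 7 ;; .branch 1 .skip (.pop 1 ;; .push 8 false) (.pop 1 ;; .push 8 true))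
        { s with wit := [], un := unary (n + 1), tmp := z }
        { s with wit := [], un := unary n, tmp := z } 3 rfl
      have h' := ih [] z s
      rw [List.drop_nil, List.take_nil] at h' ⊢
      exact (Run.loopStep (List.cons_ne_nil _ _) h h').mono (by omega)
    | cons b w =>
      have h := Run.eval (O := O)
        (.pop 7 ;; .branch 1 .skip (.pop 1 ;; .push 8 false) (.pop 1 ;; .push 8 true))
        { s with wit := b :: w, un := unary (n + 1), tmp := z }
        { s with wit := w, un := unary n, tmp := b :: z } 4 (by cases b <;> rfl)
      rw [List.drop_succ_cons, List.take_succ_cons, List.reverse_cons,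
        List.append_assoc (w.take n).reverse]
      exact (Run.loopStep (List.cons_ne_nil _ _) h (ih w (b :: z) s)).mono (by omega)

def countTrueStep : Prog :=
  .branch 1 .skip (.pop 1 ;; .push 8 false) (.pop 1 ;; .push 8 true ;; .push 13 true)

/-- Move stack `1` to stack `8` and add the number of symbols `true` to stack `13`. -/
def countTrue : Prog := .loop 1 countTrueStep

theorem countTrue_run (w : List Bool) : ∀ (z : List Bool) (e : ℕ) (s : St),
    Run O countTrue { s with wit := w, tmp := z, bad := unary e }.toStore (5 * w.length + 1)
      { s with wit := [], tmp := w.reverse ++ z, bad := unary (e + w.count true) }.toStore := by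
  induction w with
  | nil => exact fun z e s => Run.loopDone rfl
  | cons b w ih =>
    intro z e s
    have h := Run.eval (O := O) countTrueStep
      { s with wit := b :: w, tmp := z, bad := unary e }
      { s with wit := w, tmp := b :: z, bad := unary (e + b.toNat) } (3 + b.toNat)
      (by cases b <;> rfl)
    have hc : e + (b :: w).count true = e + b.toNat + w.count true := by
      cases b <;> simp; ring
    have hb := Bool.toNat_le b
    rw [hc, List.reverse_cons, List.append_assoc w.reverse]
    refine (Run.loopStep (List.cons_ne_nil _ _) h (ih (b :: z) (e + b.toNat) s)).mono ?_
    rw [List.length_cons]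
    omega

/-- Count on stack `13` the violations of the convention that the first symbol of the word on
stack `1`, and the symbols whose positions are at least the number on stack `7`, are `false`. -/
def checkWitness : Prog :=
  .branch 1 .skip .skip (.push 13 true) ;; skipSymbols ;; countTrue ;; .move 8 1

/-- The number of violations that `checkWitness` counts. -/
def witnessDefect (n : ℕ) (w : List Bool) : ℕ :=
  (w.headD false).toNat + (w.drop n).count true

theorem checkWitness_run {n L : ℕ} (hn : n ≤ L) {w : List Bool} (hw : w.length ≤ L) (s : St) :
    Run O checkWitness { s with wit := w, un := unary n, tmp := [], bad := [] }.toStore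
      (14 * L + 6)
      { s with wit := w, un := [], tmp := [], bad := unary (witnessDefect n w) }.toStore := by
  have r₁ := Run.eval (O := O) (.branch 1 .skip .skip (.push 13 true))
    { s with wit := w, un := unary n, tmp := [], bad := [] }
    { s with wit := w, un := unary n, tmp := [], bad := unary (w.headD false).toNat } 2
    (by rcases w with _ | ⟨_ | _, w⟩ <;> rfl)
  have r₂ := skipSymbols_run (O := O) n w [] { s with bad := unary (w.headD false).toNat }
  have r₃ := countTrue_run (O := O) (w.drop n) ((w.take n).reverse ++ []) (w.headD false).toNat
    { s with un := [] }
  have r₄ := St.move (O := O)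
    { s with wit := [], un := [], tmp := (w.drop n).reverse ++ ((w.take n).reverse ++ []),
             bad := unary (witnessDefect n w) } 8 1
  simp only [St.get, St.set, List.append_nil, List.reverse_append, List.reverse_reverse,
    List.take_append_drop, List.length_append, List.length_reverse, List.length_drop,
    List.length_take] at r₂ r₃ r₄
  refine (r₁.seq (r₂.seq (r₃.seq r₄))).mono ?_
  omega

/-- Push to stack `12` the symbol of the word on stack `1` whose position is on stack `7`. -/
def lookup : Prog :=
  skipSymbols ;; .branch 1 .skip (.push 12 false) (.push 12 true) ;; .move 8 1

theorem lookup_run {a L : ℕ} {w : List Bool} (ha : a < w.length) (hw : w.length ≤ L) (s : St) :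
    Run O lookup { s with wit := w, un := unary a, tmp := [] }.toStore (9 * L + 4)
      { s with wit := w, un := [], tmp := [], bit := w.getD a false :: s.bit }.toStore := by
  have r₁ := skipSymbols_run (O := O) a w [] s
  have hd : w.drop a = w.getD a false :: w.drop (a + 1) := by
    rw [List.drop_eq_getElem_cons ha, List.getD_eq_getElem _ _ ha]
  have r₂ := Run.eval (O := O) (.branch 1 .skip (.push 12 false) (.push 12 true))
    { s with wit := w.getD a false :: w.drop (a + 1), un := [], tmp := (w.take a).reverse ++ [] }
    { s with wit := w.getD a false :: w.drop (a + 1), un := [], tmp := (w.take a).reverse ++ [],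
             bit := w.getD a false :: s.bit } 2 (by cases w.getD a false <;> rfl)
  rw [← hd] at r₂
  have r₃ := St.move (O := O) { s with
    wit := w.drop a, un := [], tmp := (w.take a).reverse ++ [],
    bit := w.getD a false :: s.bit } 8 1
  simp only [St.get, St.set, List.append_nil, List.reverse_reverse, List.take_append_drop,
    List.length_reverse, List.length_take] at r₁ r₂ r₃
  refine (r₁.seq (r₂.seq r₃)).mono ?_
  omega

/-- A working state of the verifier: the remaining input, the witness, the bits of the required
size, the number of crossing edges, and the number of violations found so far. -/
abbrev verifyState (inp w k : List Bool) (m e : ℕ) : St :=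
  ⟨inp, w, k, [], unary m, [], [], [], [], [], [], [], [], unary e⟩

/-- Add one to the number on stack `4` if the two symbols on stack `12` differ. -/
def compareSymbols : Prog :=
  .branch 12 .skip
    (.pop 12 ;; .branch 12 .skip (.pop 12) (.pop 12 ;; .push 4 true))
    (.pop 12 ;; .branch 12 .skip (.pop 12 ;; .push 4 true) (.pop 12))

def edgeStep : Prog := .pop 0 ;; readNum ;; lookup ;; readNum ;; lookup ;; compareSymbols

theorem edgeStep_run {u v L : ℕ} {w : List Bool} (hu : u < w.length) (hv : v < w.length)
    (hw : w.length ≤ L) (rest k : List Bool) (m e : ℕ) :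
    Run O edgeStep (verifyState (encodePair (u, v) ++ rest) w k m e).toStore (50 * (L + 1) ^ 2)
      (verifyState rest w k (m + (w.getD u false != w.getD v false).toNat) e).toStore := by
  have r₁ := Run.eval (O := O) (.pop 0) (verifyState (encodePair (u, v) ++ rest) w k m e)
    (verifyState (encodeNat u ++ encodeNat v ++ rest) w k m e) 1 rfl
  rw [List.append_assoc] at r₁
  have r₂ := readNum_run (O := O) u L (by omega) (encodeNat v ++ rest)
    (verifyState (encodeNat u ++ (encodeNat v ++ rest)) w k m e)
  have r₃ := lookup_run (O := O) hu hw (verifyState (encodeNat v ++ rest) w k m e)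
  have r₄ := readNum_run (O := O) v L (by omega) rest
    { verifyState (encodeNat v ++ rest) w k m e with bit := [w.getD u false] }
  have r₅ := lookup_run (O := O) hv hw
    { verifyState rest w k m e with bit := [w.getD u false] }
  have r₆ := Run.eval (O := O) compareSymbols
    { verifyState rest w k m e with bit := [w.getD v false, w.getD u false] }
    (verifyState rest w k (m + (w.getD u false != w.getD v false).toNat) e)
    (4 + (w.getD u false != w.getD v false).toNat)
    (by cases w.getD u false <;> cases w.getD v false <;> rfl)
  refine (r₁.seq (r₂.seq (r₃.seq (r₄.seq (r₅.seq r₆))))).mono ?_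
  have := Bool.toNat_le (w.getD u false != w.getD v false)
  nlinarith

/-- The number of edges in the list whose endpoints have different colours. -/
def crossings (f : ℕ → Bool) (l : List (ℕ × ℕ)) : ℕ := l.countP fun e => f e.1 != f e.2

theorem crossings_cons (f : ℕ → Bool) (e : ℕ × ℕ) (l : List (ℕ × ℕ)) :
    crossings f (e :: l) = (f e.1 != f e.2).toNat + crossings f l := by
  rw [crossings, List.countP_cons, ← crossings]
  cases f e.1 != f e.2 <;> simp [add_comm]

def edgeLoop : Prog := .loop 0 (.branch 0 .skip (.pop 0) edgeStep)

theorem edgeLoop_run {L : ℕ} {w : List Bool} (hw : w.length ≤ L) (k : List Bool) (e : ℕ)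
    (l : List (ℕ × ℕ)) : ∀ m : ℕ, (∀ c ∈ l, c.1 < w.length ∧ c.2 < w.length) →
    Run O edgeLoop (verifyState (encodePairs l) w k m e).toStore
      (l.length * (52 * (L + 1) ^ 2) + 4)
      (verifyState [] w k (m + crossings (fun i => w.getD i false) l) e).toStore := by
  induction l with
  | nil =>
    intro m _
    have r := Run.eval (O := O) (.branch 0 .skip (.pop 0) edgeStep)
      (verifyState (encodePairs []) w k m e) (verifyState [] w k m e) 2 rfl
    exact (Run.loopStep (List.cons_ne_nil _ _) r (Run.loopDone rfl)).mono (by simp)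
  | cons c l ih =>
    intro m hl
    obtain ⟨hc, hl⟩ := List.forall_mem_cons.mp hl
    have r := edgeStep_run (O := O) hc.1 hc.2 hw (encodePairs l) k m e
    have r' := Run.loopStep (i := 0) (by exact List.cons_ne_nil _ _)
      (Run.branchTrue (p := .skip) (q := .pop 0) (i := 0) rfl r) (ih _ hl)
    refine r'.of_eq (by simp [encodePairs]) ?_ ?_
    · rw [crossings_cons, add_assoc]
    · rw [List.length_cons]
      nlinarith

/-- The number of positions where two words differ, and possibly one more if the second word is
longer. -/
def mismatch : List Bool → List Bool → ℕ
  | [], [] => 0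
  | [], _ :: _ => 1
  | _ :: l, [] => mismatch l [] + 1
  | b :: l, c :: r => mismatch l r + (b != c).toNat

/-- Only the vanishing of the count matters to the verifier, so its precise value on unequal words
may be convenient rather than canonical. -/
theorem mismatch_eq_zero : ∀ {l r : List Bool}, mismatch l r = 0 ↔ l = r
  | [], [] => by simp [mismatch]
  | [], _ :: _ => by simp [mismatch]
  | _ :: l, [] => by simp [mismatch]
  | b :: l, c :: r => by
    have := mismatch_eq_zero (l := l) (r := r)
    cases b <;> cases c <;> simp [mismatch, this]

def compareStep : Prog :=
  .branch 9 .skip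
    (.branch 2 (.push 13 true) (.pop 2) (.pop 2 ;; .push 13 true))
    (.branch 2 (.push 13 true) (.pop 2 ;; .push 13 true) (.pop 2)) ;; .pop 9

/-- Compare the words on the stacks `9` and `2`. -/
def compareWords : Prog :=
  .loop 9 compareStep ;; .branch 2 .skip (.push 13 true) (.push 13 true)

theorem compareWords_run (l r : List Bool) (s : St) (e : ℕ) :
    Run O compareWords { s with a := r, x := l, bad := unary e }.toStore (6 * l.length + 3)
      { s with a := r.drop l.length, x := [], bad := unary (e + mismatch l r) }.toStore := by
  -- The loop consumes `l` only; a nonempty rest of `r` is charged by the branch after the loop,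
  -- hence the correction term in the invariant.
  suffices key : ∀ (l r : List Bool) (e : ℕ), ∃ e',
      Run O (.loop 9 compareStep) { s with a := r, x := l, bad := unary e }.toStore
        (6 * l.length + 1) { s with a := r.drop l.length, x := [], bad := unary e' }.toStore ∧
      e' + (if r.drop l.length = [] then 0 else 1) = e + mismatch l r by
    obtain ⟨e', h, he⟩ := key l r e
    have h' : Run O (.branch 2 .skip (.push 13 true) (.push 13 true))
        { s with a := r.drop l.length, x := [], bad := unary e' }.toStore 2
        { s with a := r.drop l.length, x := [], bad := unary (e + mismatch l r) }.toStore := by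
      rw [← he]
      rcases r.drop l.length with _ | ⟨_ | _, d⟩ <;> exact Run.eval _ _ _ 2 rfl
    exact (h.seq h').mono (by omega)
  intro l
  induction l with
  | nil =>
    intro r e
    exact ⟨e, Run.loopDone rfl, by cases r <;> simp [mismatch]⟩
  | cons b l ih =>
    intro r e
    cases r with
    | nil =>
      have h := Run.eval (O := O) compareStep { s with a := [], x := b :: l, bad := unary e }
        { s with a := [], x := l, bad := unary (e + 1) } 4 (by cases b <;> rfl)
      obtain ⟨e', h', he⟩ := ih [] (e + 1)
      refine ⟨e', (Run.loopStep (List.cons_ne_nil _ _) h (h'.of_eq rfl ?_ le_rfl)).mono ?_, ?_⟩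
      · simp
      · rw [List.length_cons]; omega
      · simp [mismatch] at he ⊢
        omega
    | cons c r =>
      have h := Run.eval (O := O) compareStep { s with a := c :: r, x := b :: l, bad := unary e }
        { s with a := r, x := l, bad := unary (e + (b != c).toNat) } (4 + (b != c).toNat)
        (by cases b <;> cases c <;> rfl)
      obtain ⟨e', h', he⟩ := ih r (e + (b != c).toNat)
      refine ⟨e', (Run.loopStep (List.cons_ne_nil _ _) h h').mono ?_, ?_⟩
      · have := Bool.toNat_le (b != c)
        rw [List.length_cons]
        omega
      · rw [List.length_cons, List.drop_succ_cons, he, mismatch]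
        ring

/-- The verifier. -/
def verify : Prog :=
  readNum ;; checkWitness ;; readBits ;; .move 6 2 ;; edgeLoop ;;
  .move 4 7 ;; emit ;; .move 5 0 ;; readBits ;; .move 6 9 ;; compareWords ;;
  .branch 13 (.push 0 true) (.push 0 false) (.push 0 false)

/-- The required size `k` stays in binary, since its value need not be polynomially bounded. The
number of crossing edges is at most the number of edges; it is counted in unary and converted to
binary for the comparison. Defects are accumulated on stack `13`, as programs cannot abort. -/
theorem verify_run {n L : ℕ} {k w : List Bool} {l : List (ℕ × ℕ)} (hn : n ≤ L)
    (hw : w.length ≤ L) (hk : k.length ≤ L) (hl : l.length ≤ L)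
    (hlw : ∀ c ∈ l, c.1 < w.length ∧ c.2 < w.length) :
    ∃ s : Store, s 0 = [decide (witnessDefect n w +
        mismatch (crossings (fun i => w.getD i false) l).bits k = 0)] ∧
      Run O verify (initStore (encodeNat n ++ (encodeBits k ++ encodePairs l)) w)
        (200 * (L + 1) ^ 3) s := by
  set m := crossings (fun i => w.getD i false) l with hm
  have hmL : m ≤ L := List.countP_le_length.trans hl
  set e := witnessDefect n w with he
  refine ⟨{ verifyState [decide (e + mismatch m.bits k = 0)] w (k.drop m.bits.length) 0
    (e + mismatch m.bits k) with x := [] }.toStore, rfl, ?_⟩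
  rw [← St.toStore_init]
  have r₁ := readNum_run (O := O) n L hn (encodeBits k ++ encodePairs l)
    (St.init (encodeNat n ++ (encodeBits k ++ encodePairs l)) w)
  have r₂ := checkWitness_run (O := O) hn hw
    (verifyState (encodeBits k ++ encodePairs l) w [] 0 0)
  have r₃ := readBits_run (O := O) k (encodePairs l)
    (verifyState (encodeBits k ++ encodePairs l) w [] 0 e)
  have r₄ := St.move (O := O)
    { verifyState (encodePairs l) w [] 0 e with dig := k.reverse ++ [] } 6 2
  have r₅ := edgeLoop_run (O := O) hw k e l 0 hlw
  have r₆ := St.move (O := O) (verifyState [] w k (0 + m) e) 4 7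
  have r₇ := emit_run (O := O) m L hmL (verifyState [] w k 0 e)
  have r₈ := St.move (O := O)
    { verifyState [] w k 0 e with out := (encodeNat m).reverse ++ [] } 5 0
  have r₉ := readBits_run (O := O) m.bits [] (verifyState (encodeNat m) w k 0 e)
  have r₁₀ := St.move (O := O) { verifyState [] w k 0 e with dig := m.bits.reverse ++ [] } 6 9
  have r₁₁ := compareWords_run (O := O) m.bits k (verifyState [] w k 0 e) e
  have r₁₂ : Run O (.branch 13 (.push 0 true) (.push 0 false) (.push 0 false))
      (verifyState [] w (k.drop m.bits.length) 0 (e + mismatch m.bits k)).toStore 2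
      (verifyState [decide (e + mismatch m.bits k = 0)] w (k.drop m.bits.length) 0
        (e + mismatch m.bits k)).toStore := by
    rcases e + mismatch m.bits k with _ | d <;> exact Run.eval _ _ _ 2 rfl
  have hmb := (length_bits_le m).trans hmL
  have hme := length_encodeNat_le m
  simp only [St.get, St.set, List.append_nil, List.reverse_reverse, List.length_reverse,
    List.reverse_replicate, List.length_replicate, zero_add, List.replicate_zero]
    at r₂ r₃ r₄ r₅ r₆ r₇ r₈ r₉ r₁₀ r₁₁
  refine (r₁.seq (r₂.seq (r₃.seq (r₄.seq (r₅.seq (r₆.seq (r₇.seq (r₈.seq (r₉.seq (r₁₀.seq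
    (r₁₁.seq r₁₂))))))))))).mono ?_
  have h₁ : l.length * (52 * (L + 1) ^ 2) ≤ L * (52 * (L + 1) ^ 2) := Nat.mul_le_mul_right _ hl
  have h₂ : L * (52 * (L + 1) ^ 2) = 52 * L ^ 3 + 104 * L ^ 2 + 52 * L := by ring
  have h₃ : (L + 1) ^ 3 = L ^ 3 + 3 * L ^ 2 + 3 * L + 1 := by ring
  have h₄ : (L + 1) ^ 2 = L ^ 2 + 2 * L + 1 := by ring
  rw [h₂] at h₁
  rw [h₃]
  rw [h₄] at h₁ ⊢
  omega

end Verifier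

/-! ### Cuts and two-colourings -/

namespace SimpleGraph

theorem crossingSet_comm {V : Type*} (G : SimpleGraph V) (X Y : Set V) :
    G.crossingSet X Y = G.crossingSet Y X := by
  ext e
  constructor <;> rintro ⟨he, a, ha, b, hb, rfl⟩ <;> exact ⟨he, b, hb, a, ha, Sym2.eq_swap⟩

end SimpleGraph

namespace GraphWithNumber

variable {I : GraphWithNumber}

/-- The vertices of colour `true`. -/
def shore (I : GraphWithNumber) (f : ℕ → Bool) : Set (Fin I.n) := {v | f v = true}

theorem graph_adj (hl : ∀ e ∈ I.edges, e.1 ≠ e.2) {a b : Fin I.n} :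
    I.graph.Adj a b ↔ ((a : ℕ), (b : ℕ)) ∈ I.edges ∨ ((b : ℕ), (a : ℕ)) ∈ I.edges := by
  rw [graph, SimpleGraph.fromRel_adj]
  refine ⟨fun h => h.2, fun h => ⟨?_, h⟩⟩
  rintro rfl
  rcases h with h | h <;> exact hl _ h rfl

/-- The edges are compared inside `Sym2 ℕ`; counting list entries counts edges because no edge is
listed twice in either orientation. -/
theorem ncard_crossingSet (hv : ∀ e ∈ I.edges, e.1 < I.n ∧ e.2 < I.n)
    (hl : ∀ e ∈ I.edges, e.1 ≠ e.2) (hd : (I.edges.map fun e => s(e.1, e.2)).Nodup)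
    (f : ℕ → Bool) :
    (I.graph.crossingSet (I.shore f) (I.shore f)ᶜ).ncard = crossings f I.edges := by
  have hinj : Function.Injective (Sym2.map (Fin.val : Fin I.n → ℕ)) :=
    Sym2.map.injective Fin.val_injective
  rw [← Set.ncard_image_of_injective _ hinj]
  have himg : Sym2.map (Fin.val : Fin I.n → ℕ) '' (I.graph.crossingSet (I.shore f) (I.shore f)ᶜ) =
      ↑((I.edges.filter fun e => f e.1 != f e.2).map fun e => s(e.1, e.2)).toFinset := by
    ext z
    simp only [Set.mem_image, List.coe_toFinset, Set.mem_ofPred_eq, List.mem_map, List.mem_filter]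
    constructor
    · rintro ⟨_, ⟨he, a, ha, b, hb, rfl⟩, rfl⟩
      rw [SimpleGraph.mem_edgeSet, graph_adj hl] at he
      have ha' : f a = true := ha
      have hb' : f b = false := by simpa [shore] using hb
      rcases he with he | he
      · exact ⟨_, ⟨he, by simp [ha', hb']⟩, rfl⟩
      · exact ⟨_, ⟨he, by simp [ha', hb']⟩, Sym2.eq_swap⟩
    · rintro ⟨⟨a, b⟩, ⟨he, hf⟩, rfl⟩
      obtain ⟨ha, hb⟩ := hv _ he
      dsimp only at ha hb hf
      have hadj : I.graph.Adj ⟨a, ha⟩ ⟨b, hb⟩ := (graph_adj hl).mpr (Or.inl he)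
      refine ⟨s(⟨a, ha⟩, ⟨b, hb⟩), ⟨hadj, ?_⟩, rfl⟩
      cases hfa : f a
      · refine ⟨⟨b, hb⟩, ?_, ⟨a, ha⟩, ?_, Sym2.eq_swap⟩
        · simpa [shore, hfa] using hf
        · simp [shore, hfa]
      · refine ⟨⟨a, ha⟩, hfa, ⟨b, hb⟩, ?_, rfl⟩
        simpa [shore, hfa] using hf
  rw [himg, Set.ncard_coe_finset, List.toFinset_card_of_nodup, List.length_map, crossings,
    List.countP_eq_length_filter]
  exact hd.sublist (List.filter_sublist.map _)

/-- Cuts of size `k` correspond to the two-colourings with `k` crossing edges in which a given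
vertex has the colour `false`. -/
theorem cutCount_eq (hv : ∀ e ∈ I.edges, e.1 < I.n ∧ e.2 < I.n)
    (hl : ∀ e ∈ I.edges, e.1 ≠ e.2) (hd : (I.edges.map fun e => s(e.1, e.2)).Nodup)
    (hk : 0 < I.k) {v : ℕ} (hvn : v < I.n) :
    I.cutCount = {f : ℕ → Bool | (∀ i, I.n ≤ i → f i = false) ∧ f v = false ∧
      crossings f I.edges = I.k}.ncard := by
  have hS : ∀ X : Set (Fin I.n), ∃ f : ℕ → Bool, (∀ i, I.n ≤ i → f i = false) ∧ I.shore f = X := by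
    classical
    intro X
    refine ⟨fun i => decide (∃ h : i < I.n, (⟨i, h⟩ : Fin I.n) ∈ X), fun i hi => ?_, ?_⟩
    · rw [decide_eq_false_iff_not]
      rintro ⟨h, _⟩
      omega
    · ext w
      simp [shore]
  symm
  refine Set.ncard_congr (fun f _ => s(I.shore f, (I.shore f)ᶜ)) ?_ ?_ ?_
  · rintro f ⟨_, hf, hc⟩
    rw [← ncard_crossingSet hv hl hd] at hc
    -- As `k` is positive there is a crossing edge, and its ends show that both shores are nonempty.
    obtain ⟨_, _, a, ha, b, hb, _⟩ := Set.nonempty_of_ncard_ne_zero (hc.trans_ne hk.ne')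
    exact ⟨_, _, rfl, ⟨a, ha⟩, ⟨b, hb⟩, disjoint_compl_right, Set.union_compl_self _, hc⟩
  · rintro f g ⟨hf, hfv, _⟩ ⟨hg, hgv, _⟩ h
    have hfv' : (⟨v, hvn⟩ : Fin I.n) ∉ I.shore f := by simp [shore, hfv]
    have hgv' : (⟨v, hvn⟩ : Fin I.n) ∉ I.shore g := by simp [shore, hgv]
    have hfg : I.shore f = I.shore g := by
      rcases Sym2.eq_iff.mp h with h | h
      · exact h.1
      · rw [h.1] at hfv'
        exact absurd hgv' hfv'
    funext i
    rcases lt_or_ge i I.n with hi | hi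
    · have : (⟨i, hi⟩ : Fin I.n) ∈ I.shore f ↔ (⟨i, hi⟩ : Fin I.n) ∈ I.shore g := by rw [hfg]
      exact Bool.eq_iff_iff.mpr this
    · rw [hf i hi, hg i hi]
  · rintro C ⟨X, Y, rfl, _, _, hXY, hU, hc⟩
    have hY : Y = Xᶜ := (IsCompl.compl_eq ⟨hXY, codisjoint_iff.mpr hU⟩).symm
    -- The colour `true` goes to the shore that does not contain `v`.
    by_cases hvX : (⟨v, hvn⟩ : Fin I.n) ∈ X
    · obtain ⟨f, hf, hfY⟩ := hS Y
      have hX : X = Yᶜ := by rw [hY, compl_compl]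
      refine ⟨f, ⟨hf, ?_, ?_⟩, ?_⟩
      · have : (⟨v, hvn⟩ : Fin I.n) ∉ I.shore f := by rw [hfY, hY]; simpa using hvX
        simpa [shore] using this
      · rw [← ncard_crossingSet hv hl hd, hfY, ← hX, SimpleGraph.crossingSet_comm, hc]
      · rw [hfY, ← hX, Sym2.eq_swap]
    · obtain ⟨f, hf, hfX⟩ := hS X
      refine ⟨f, ⟨hf, ?_, ?_⟩, ?_⟩
      · have : (⟨v, hvn⟩ : Fin I.n) ∉ I.shore f := by rwa [hfX]
        simpa [shore] using this
      · rw [← ncard_crossingSet hv hl hd, hfX, ← hY, hc]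
      · rw [hfX, ← hY]

end GraphWithNumber

/-! ### The union of the circuits -/

section Circuits

theorem mem_circuitEdges {h p u v : ℕ} {e : ℕ × ℕ} (he : e ∈ circuitEdges h p u v) :
    e = (h, p + 1) ∨ e = (p + 1, p + 2) ∨ e = (p + 2, u) ∨ e = (u, p + 3) ∨ e = (p + 3, p + 4) ∨
      e = (p + 4, v) ∨ e = (v, p + 5) ∨ e = (p + 5, p + 6) ∨ e = (p + 6, h) := by
  simpa only [circuitEdges, List.mem_cons, List.not_mem_nil, or_false] using he

/-- The last conjunct gives edge-disjointness: every edge has an end among the new vertices, which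
are larger than all vertices of earlier circuits. -/
theorem circuitEdges_bounds {h p u v : ℕ} (hp : h ≤ p) (hu : u < h) (hv : v < h) {e : ℕ × ℕ}
    (he : e ∈ circuitEdges h p u v) :
    e.1 ≤ p + 6 ∧ e.2 ≤ p + 6 ∧ e.1 ≠ e.2 ∧ p < max e.1 e.2 := by
  rcases mem_circuitEdges he with rfl | rfl | rfl | rfl | rfl | rfl | rfl | rfl | rfl <;>
    dsimp only <;> omega

theorem circuitEdges_nodup {h p u v : ℕ} (hp : h ≤ p) (hu : u < h) (hv : v < h) (_ : u ≠ v) :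
    ((circuitEdges h p u v).map fun e => s(e.1, e.2)).Nodup := by
  simp only [circuitEdges, List.map_cons, List.map_nil, List.nodup_cons, List.mem_cons,
    List.not_mem_nil, or_false, Sym2.eq_iff, List.nodup_nil, not_false_eq_true, and_true]
  omega

theorem circuitsEdges_bounds {h : ℕ} (l : List (ℕ × ℕ)) (hl : ∀ c ∈ l, c.1 < h ∧ c.2 < h) :
    ∀ p, h ≤ p → ∀ e ∈ circuitsEdges h p l,
      e.1 ≤ p + 6 * l.length ∧ e.2 ≤ p + 6 * l.length ∧ e.1 ≠ e.2 ∧ p < max e.1 e.2 := by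
  induction l with
  | nil => simp [circuitsEdges]
  | cons c l ih =>
    obtain ⟨hc, hl⟩ := List.forall_mem_cons.mp hl
    intro p hp e he
    rw [List.length_cons]
    rcases List.mem_append.mp he with he | he
    · have := circuitEdges_bounds hp hc.1 hc.2 he
      omega
    · have := ih hl (p + 6) (by omega) e he
      omega

theorem circuitsEdges_nodup {h : ℕ} (l : List (ℕ × ℕ)) (hl : ∀ c ∈ l, c.1 < h ∧ c.2 < h)
    (hd : ∀ c ∈ l, c.1 ≠ c.2) :
    ∀ p, h ≤ p → ((circuitsEdges h p l).map fun e => s(e.1, e.2)).Nodup := by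
  induction l with
  | nil => simp [circuitsEdges]
  | cons c l ih =>
    obtain ⟨hc, hl⟩ := List.forall_mem_cons.mp hl
    obtain ⟨hdc, hd⟩ := List.forall_mem_cons.mp hd
    intro p hp
    rw [circuitsEdges, List.map_append, List.nodup_append']
    refine ⟨circuitEdges_nodup hp hc.1 hc.2 hdc, ih hl hd (p + 6) (by omega), ?_⟩
    intro z hz hz'
    obtain ⟨e, he, rfl⟩ := List.mem_map.mp hz
    obtain ⟨e', he', hee⟩ := List.mem_map.mp hz'
    have h₁ := circuitEdges_bounds hp hc.1 hc.2 he
    have h₂ := circuitsEdges_bounds l hl (p + 6) (by omega) e' he'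
    rcases Sym2.eq_iff.mp hee with h | h <;> omega

theorem circuitEdges_subset {h : ℕ} (l : List (ℕ × ℕ)) : ∀ (p j : ℕ) (c : ℕ × ℕ),
    l[j]? = some c → circuitEdges h (p + 6 * j) c.1 c.2 ⊆ circuitsEdges h p l := by
  induction l with
  | nil => simp
  | cons d l ih =>
    intro p j c hj
    rw [circuitsEdges]
    cases j with
    | zero =>
      obtain rfl : d = c := by simpa using hj
      exact List.subset_append_left _ _
    | succ j =>
      rw [List.getElem?_cons_succ] at hj
      have := ih (p + 6) j c hj
      rw [show p + 6 + 6 * j = p + 6 * (j + 1) by ring] at this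
      exact List.subset_append_of_subset_right _ this

/-- The number of crossing edges of a circuit whose hub has the colour `false`, whose variables
have the colours `x` and `y`, and whose other vertices have the colours `c`. -/
def circuitCrossings (x y : Bool) (c : Fin 6 → Bool) : ℕ :=
  (false != c 0).toNat + ((c 0 != c 1).toNat + ((c 1 != x).toNat + ((x != c 2).toNat +
    ((c 2 != c 3).toNat + ((c 3 != y).toNat + ((y != c 4).toNat + ((c 4 != c 5).toNat +
      (c 5 != false).toNat)))))))

theorem crossings_circuitEdges {f : ℕ → Bool} {h : ℕ} (hf : f h = false) (p u v : ℕ) :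
    crossings f (circuitEdges h p u v) =
      circuitCrossings (f u) (f v) fun i => f (p + 1 + i) := by
  simp only [circuitEdges, crossings_cons, hf]
  rfl

/-- A closed circuit changes colour an even number of times, so nine changes are impossible; the
finitely many colourings are checked by `decide`. -/
theorem circuitCrossings_le (x y : Bool) (c : Fin 6 → Bool) : circuitCrossings x y c ≤ 8 := by
  rw [circuitCrossings]
  generalize c 0 = c₀, c 1 = c₁, c 2 = c₂, c 3 = c₃, c 4 = c₄, c 5 = c₅
  revert x y c₀ c₁ c₂ c₃ c₄ c₅
  decide

/-- Eight crossings require two paths with different ends, fully crossing, and one with equal ends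
and a single monochromatic edge, which can be any of its three edges. If both variables agree with
the hub, no path has different ends. -/
theorem card_circuitCrossings_eq (x y : Bool) :
    Fintype.card {c : Fin 6 → Bool // circuitCrossings x y c = 8} =
      if x = true ∨ y = true then 3 else 0 := by
  revert x y
  decide +kernel

theorem crossings_append (f : ℕ → Bool) (l l' : List (ℕ × ℕ)) :
    crossings f (l ++ l') = crossings f l + crossings f l' := List.countP_append

/-- A sum of terms that are at most 8 is maximal exactly when every term is 8. -/
theorem crossings_circuitsEdges {f : ℕ → Bool} {h : ℕ} (hf : f h = false) (l : List (ℕ × ℕ)) :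
    ∀ p, crossings f (circuitsEdges h p l) ≤ 8 * l.length ∧
      (crossings f (circuitsEdges h p l) = 8 * l.length ↔
        ∀ (j : ℕ) (hj : j < l.length),
          circuitCrossings (f l[j].1) (f l[j].2) (fun i => f (p + 6 * j + 1 + i)) = 8) := by
  induction l with
  | nil => simp [circuitsEdges, crossings]
  | cons c l ih =>
    intro p
    obtain ⟨h₁, h₂⟩ := ih (p + 6)
    have h₃ := circuitCrossings_le (f c.1) (f c.2) fun i => f (p + 1 + i)
    rw [← crossings_circuitEdges hf] at h₃
    rw [circuitsEdges, crossings_append]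
    refine ⟨by rw [List.length_cons]; omega, ?_⟩
    have h₄ : crossings f (circuitEdges h p c.1 c.2) + crossings f (circuitsEdges h (p + 6) l) =
        8 * (c :: l).length ↔ crossings f (circuitEdges h p c.1 c.2) = 8 ∧
          crossings f (circuitsEdges h (p + 6) l) = 8 * l.length := by
      rw [List.length_cons]; omega
    rw [h₄, h₂, crossings_circuitEdges hf]
    constructor
    · rintro ⟨h₅, h₆⟩ j hj
      cases j with
      | zero => exact h₅
      | succ j =>
        have := h₆ j (Nat.lt_of_succ_lt_succ hj)
        rw [show p + 6 + 6 * j = p + 6 * (j + 1) by ring] at this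
        exact this
    · intro h₅
      refine ⟨h₅ 0 (Nat.succ_pos _), fun j hj => ?_⟩
      have := h₅ (j + 1) (Nat.succ_lt_succ hj)
      rw [show p + 6 * (j + 1) = p + 6 + 6 * j by ring] at this
      exact this

end Circuits

/-! ### The graph of a formula: validity and the number of its maximum cuts. -/

namespace MonotoneFormula

variable (φ : MonotoneFormula)

/-- The clauses as pairs of numbers. -/
abbrev pairs : List (ℕ × ℕ) := φ.clauses.map fun c => ((c.1 : ℕ), (c.2 : ℕ))

/-- The clause index `j` becomes the running offset `p = φ.n + 6 * j`, the form in which the program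
and the inductions handle it. -/
theorem edges_toMaxCut : φ.toMaxCut.edges = circuitsEdges φ.n φ.n φ.pairs := by
  have key : ∀ (l : List (Fin φ.n × Fin φ.n)) (k : ℕ),
      ((l.zipIdx k).flatMap fun cj => φ.clauseCircuit cj.1 cj.2) =
        circuitsEdges φ.n (φ.n + 6 * k) (l.map fun c => ((c.1 : ℕ), (c.2 : ℕ))) := by
    intro l
    induction l with
    | nil => exact fun k => rfl
    | cons c l ih =>
      intro k
      rw [List.zipIdx_cons, List.flatMap_cons, ih (k + 1), List.map_cons, circuitsEdges]
      rfl
  exact key φ.clauses 0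

theorem pairs_lt {c : ℕ × ℕ} (hc : c ∈ φ.pairs) : c.1 < φ.n ∧ c.2 < φ.n := by
  obtain ⟨d, _, rfl⟩ := List.mem_map.mp hc
  exact ⟨d.1.2, d.2.2⟩

variable {φ}

theorem Valid.pairs_ne (hφ : φ.Valid) {c : ℕ × ℕ} (hc : c ∈ φ.pairs) : c.1 ≠ c.2 := by
  obtain ⟨d, hd, rfl⟩ := List.mem_map.mp hc
  exact fun h => hφ.distinct d hd (Fin.ext h)

theorem Valid.toMaxCut_connected (hφ : φ.Valid) : φ.toMaxCut.graph.Connected := by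
  have hN : φ.toMaxCut.n = φ.n + 1 + 6 * φ.clauses.length := rfl
  have hb := circuitsEdges_bounds φ.pairs (fun c hc => φ.pairs_lt hc) φ.n le_rfl
  rw [List.length_map, ← edges_toMaxCut] at hb
  have hhub : φ.n < φ.toMaxCut.n := by omega
  set R : ℕ → Prop := fun i => ∀ hi : i < φ.toMaxCut.n,
    φ.toMaxCut.graph.Reachable ⟨φ.n, hhub⟩ ⟨i, hi⟩ with hR
  have hstep : ∀ {i j : ℕ}, (i, j) ∈ φ.toMaxCut.edges → R i → R j := by
    intro i j hij hi hj
    have hi' : i < φ.toMaxCut.n := by have := (hb _ hij).1; dsimp only at this; omega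
    refine (hi hi').trans (SimpleGraph.Adj.reachable ?_)
    exact (GraphWithNumber.graph_adj fun e he => (hb e he).2.2.1).mpr (Or.inl hij)
  have h₀ : R φ.n := fun _ => SimpleGraph.Reachable.refl _
  have hcirc : ∀ (j : ℕ) (c : ℕ × ℕ), φ.pairs[j]? = some c →
      R c.1 ∧ R c.2 ∧ ∀ i, 1 ≤ i → i ≤ 6 → R (φ.n + 6 * j + i) := by
    intro j c hj
    have hsub := circuitEdges_subset (h := φ.n) φ.pairs φ.n j c hj
    rw [← edges_toMaxCut] at hsub
    have hmem : ∀ e ∈ circuitEdges φ.n (φ.n + 6 * j) c.1 c.2, R e.1 → R e.2 :=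
      fun e he => hstep (hsub he)
    simp only [circuitEdges, List.forall_mem_cons] at hmem
    obtain ⟨m₁, m₂, m₃, m₄, m₅, m₆, m₇, m₈, -⟩ := hmem
    have r₁ := m₁ h₀
    have r₂ := m₂ r₁
    have r₃ := m₃ r₂
    have r₄ := m₄ r₃
    have r₅ := m₅ r₄
    have r₆ := m₆ r₅
    have r₇ := m₇ r₆
    have r₈ := m₈ r₇
    refine ⟨r₃, r₆, fun i hi hi' => ?_⟩
    interval_cases i <;> assumption
  have hall : ∀ i, R i := by
    intro i hi
    rcases lt_trichotomy i φ.n with h | rfl | h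
    -- A variable is reached through the circuit of a clause in which it occurs.
    · obtain ⟨c, hc, hic⟩ := hφ.occurs ⟨i, h⟩
      obtain ⟨j, hj⟩ := List.mem_iff_getElem?.mp hc
      have := hcirc j (c.1, c.2) (by simp [hj])
      rcases hic with hic | hic
      · rw [← hic] at this
        exact this.1 hi
      · rw [← hic] at this
        exact this.2.1 hi
    · exact h₀ hi
    · have hj : (i - φ.n - 1) / 6 < φ.pairs.length := by rw [List.length_map]; omega
      have := (hcirc _ _ (List.getElem?_eq_getElem hj)).2.2 ((i - φ.n - 1) % 6 + 1)
        (by omega) (by omega)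
      rw [show φ.n + 6 * ((i - φ.n - 1) / 6) + ((i - φ.n - 1) % 6 + 1) = i by omega] at this
      exact this hi
  rw [SimpleGraph.connected_iff_exists_forall_reachable]
  exact ⟨⟨φ.n, hhub⟩, fun v => hall v v.2⟩

theorem Valid.length_pos (hφ : φ.Valid) : 0 < φ.clauses.length :=
  List.length_pos_iff.mpr hφ.nonempty

theorem Valid.toMaxCut_valid (hφ : φ.Valid) : φ.toMaxCut.Valid := by
  have hN : φ.toMaxCut.n = φ.n + 1 + 6 * φ.clauses.length := rfl
  have hb := circuitsEdges_bounds φ.pairs (fun c hc => φ.pairs_lt hc) φ.n le_rfl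
  rw [List.length_map, ← edges_toMaxCut] at hb
  refine ⟨fun e he => ?_, fun e he => (hb e he).2.2.1, ?_, hφ.toMaxCut_connected, ?_⟩
  · have := hb e he
    omega
  · rw [edges_toMaxCut]
    exact circuitsEdges_nodup _ (fun c hc => φ.pairs_lt hc) (fun c hc => hφ.pairs_ne hc) _ le_rfl
  · have := hφ.length_pos
    change 0 < 8 * φ.clauses.length
    omega

/-- The pairs of an assignment and a colouring of the vertices of the clauses that have eight
crossing edges in each circuit. -/
def extremalColourings (φ : MonotoneFormula) :
    Set ((Fin φ.n → Bool) × (Fin φ.clauses.length → Fin 6 → Bool)) :=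
  {q | ∀ j : Fin φ.clauses.length,
    circuitCrossings (q.1 φ.clauses[j].1) (q.1 φ.clauses[j].2) (q.2 j) = 8}

/-- Over a fixed assignment the circuits can be coloured independently, so the fibre is a product of
factors 3 or 0, and it is nonempty only over satisfying assignments. -/
theorem ncard_extremalColourings (φ : MonotoneFormula) :
    φ.extremalColourings.ncard = 3 ^ φ.clauses.length * φ.satCount := by
  classical
  have e : φ.extremalColourings ≃ Σ a : Fin φ.n → Bool, ∀ j : Fin φ.clauses.length,
      {c : Fin 6 → Bool // circuitCrossings (a φ.clauses[j].1) (a φ.clauses[j].2) c = 8} :=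
    (Equiv.subtypeProdEquivSigmaSubtype fun (a : Fin φ.n → Bool)
      (c : Fin φ.clauses.length → Fin 6 → Bool) => ∀ j : Fin φ.clauses.length,
        circuitCrossings (a φ.clauses[j].1) (a φ.clauses[j].2) (c j) = 8).trans
      (Equiv.sigmaCongrRight fun a => Equiv.subtypePiEquivPi
        (p := fun (j : Fin φ.clauses.length) (c : Fin 6 → Bool) =>
          circuitCrossings (a φ.clauses[j].1) (a φ.clauses[j].2) c = 8))
  rw [← Nat.card_coe_set_eq, Nat.card_congr e, Nat.card_eq_fintype_card, Fintype.card_sigma]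
  simp only [Fintype.card_pi, card_circuitCrossings_eq]
  have hprod : ∀ a : Fin φ.n → Bool,
      (∏ j : Fin φ.clauses.length,
        if a φ.clauses[j].1 = true ∨ a φ.clauses[j].2 = true then 3 else 0) =
      if ∀ c ∈ φ.clauses, a c.1 = true ∨ a c.2 = true then 3 ^ φ.clauses.length else 0 := by
    intro a
    split_ifs with h
    · rw [Finset.prod_congr rfl fun j _ => if_pos (h _ (List.getElem_mem j.2))]
      simp
    · push Not at h
      obtain ⟨c, hc, h⟩ := h
      obtain ⟨j, hj, rfl⟩ := List.mem_iff_getElem.mp hc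
      exact Finset.prod_eq_zero (Finset.mem_univ ⟨j, hj⟩) (if_neg (by simpa using h))
  simp only [hprod]
  rw [← Finset.sum_filter, Finset.sum_const, smul_eq_mul, mul_comm, satCount,
    Set.ncard_eq_toFinset_card']
  congr 2
  ext a
  simp

/-- The colouring of the natural numbers given by an assignment and by colours of the vertices of
the clauses. -/
def colouring (φ : MonotoneFormula) (a : Fin φ.n → Bool)
    (c : Fin φ.clauses.length → Fin 6 → Bool) (i : ℕ) : Bool :=
  if h : i < φ.n then a ⟨i, h⟩
  else if h' : φ.n < i ∧ (i - φ.n - 1) / 6 < φ.clauses.length then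
    c ⟨(i - φ.n - 1) / 6, h'.2⟩ ⟨(i - φ.n - 1) % 6, Nat.mod_lt _ (by decide)⟩
  -- This covers the hub and all numbers that are not vertices, as the normalisation in
  -- `cutCount_eq` demands.
  else false

theorem colouring_var (a : Fin φ.n → Bool) (c : Fin φ.clauses.length → Fin 6 → Bool)
    (i : Fin φ.n) : φ.colouring a c i = a i := by
  simp [colouring]

theorem colouring_clause (a : Fin φ.n → Bool) (c : Fin φ.clauses.length → Fin 6 → Bool)
    (j : Fin φ.clauses.length) (r : Fin 6) : φ.colouring a c (φ.n + 6 * j + 1 + r) = c j r := by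
  have h₁ : (φ.n + 6 * (j : ℕ) + 1 + r - φ.n - 1) / 6 = j := by omega
  have h₂ : (φ.n + 6 * (j : ℕ) + 1 + r - φ.n - 1) % 6 = r := by omega
  rw [colouring, dif_neg (by omega), dif_pos ⟨by omega, by rw [h₁]; exact j.2⟩]
  simp only [h₁, h₂]

theorem Valid.cutCount_toMaxCut (hφ : φ.Valid) :
    φ.toMaxCut.cutCount = 3 ^ φ.clauses.length * φ.satCount := by
  have hV := hφ.toMaxCut_valid
  have hN : φ.toMaxCut.n = φ.n + 1 + 6 * φ.clauses.length := rfl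
  have hk : φ.toMaxCut.k = 8 * φ.pairs.length := by rw [List.length_map]; rfl
  have hmem : ∀ f : ℕ → Bool, f φ.n = false →
      (crossings f φ.toMaxCut.edges = φ.toMaxCut.k ↔ ∀ j : Fin φ.clauses.length,
        circuitCrossings (f φ.clauses[j].1) (f φ.clauses[j].2)
          (fun i => f (φ.n + 6 * j + 1 + i)) = 8) := by
    intro f hf
    rw [edges_toMaxCut, hk, (crossings_circuitsEdges hf φ.pairs φ.n).2]
    constructor
    · intro h j
      simpa using h j (by simp)
    · intro h j hj
      simpa using h ⟨j, by simpa using hj⟩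
  -- Normalising at the hub `φ.n` leaves the colours of the variables and of the clause vertices
  -- free, which is a point of `extremalColourings`.
  rw [GraphWithNumber.cutCount_eq hV.vertices hV.loopless hV.nodup hV.pos
    (v := φ.n) (by omega), ← ncard_extremalColourings]
  symm
  refine Set.ncard_congr (fun q _ => φ.colouring q.1 q.2) ?_ ?_ ?_
  · rintro ⟨a, c⟩ h
    have h₀ : φ.colouring a c φ.n = false := by simp [colouring]
    refine ⟨fun i hi => ?_, h₀, (hmem _ h₀).mpr fun j => ?_⟩
    · rw [colouring, dif_neg (by omega), dif_neg (by omega)]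
    · simp only [colouring_var, colouring_clause]
      exact h j
  · rintro ⟨a, c⟩ ⟨a', c'⟩ _ _ h
    have h' : ∀ i, φ.colouring a c i = φ.colouring a' c' i := congrFun h
    refine Prod.ext (funext fun i => ?_) (funext fun j => funext fun r => ?_)
    · change a i = a' i
      rw [← colouring_var a c, h', colouring_var]
    · change c j r = c' j r
      rw [← colouring_clause a c, h', colouring_clause]
  · rintro f ⟨hf, hf₀, hc⟩
    refine ⟨(fun i => f i, fun j r => f (φ.n + 6 * j + 1 + r)), fun j => (hmem f hf₀).mp hc j, ?_⟩
    funext i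
    rw [colouring]
    split_ifs with h h'
    · rfl
    · dsimp only
      congr 1
      omega
    · rcases eq_or_ne i φ.n with rfl | hi
      · exact hf₀.symm
      · exact (hf i (by omega)).symm

end MonotoneFormula

/-! ### Sizes of instances -/

theorem length_encodeNat_pos (n : ℕ) : 1 ≤ (encodeNat n).length := by
  simp [encodeNat]

theorem length_encodePairs_ge (l : List (ℕ × ℕ)) : 3 * l.length + 1 ≤ (encodePairs l).length := by
  induction l with
  | nil => simp [encodePairs]
  | cons e l ih =>
    have h₁ := length_encodeNat_pos e.1
    have h₂ := length_encodeNat_pos e.2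
    simp only [encodePairs, List.flatMap_cons, List.length_append, List.length_cons] at ih ⊢
    omega

namespace MonotoneFormula

variable {φ : MonotoneFormula}

/-- Although `φ.n` is encoded in binary, it is linear in the length of the code because every
variable occurs in a clause; the unary computations depend on this. -/
theorem Valid.n_le (hφ : φ.Valid) : φ.n ≤ 2 * φ.clauses.length := by
  have h : (Finset.univ : Finset (Fin φ.n)) ⊆
      (φ.clauses.flatMap fun c => [c.1, c.2]).toFinset := by
    intro i _
    obtain ⟨c, hc, hi⟩ := hφ.occurs i
    exact List.mem_toFinset.mpr (List.mem_flatMap.mpr ⟨c, hc, by simpa using hi⟩)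
  have h' := (Finset.card_le_card h).trans (List.toFinset_card_le _)
  rw [Finset.card_univ, Fintype.card_fin] at h'
  simpa [List.length_flatMap, mul_comm] using h'

theorem length_encode_ge (φ : MonotoneFormula) : 3 * φ.clauses.length + 2 ≤ φ.encode.length := by
  have h₁ := length_encodeNat_pos φ.n
  have h₂ := length_encodePairs_ge φ.pairs
  rw [List.length_map] at h₂
  change _ ≤ (encodeNat φ.n ++ encodePairs φ.pairs).length
  rw [List.length_append]
  omega

theorem satCount_le (φ : MonotoneFormula) : φ.satCount ≤ 2 ^ φ.n := by
  refine (Set.ncard_le_ncard (Set.subset_univ _)).trans ?_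
  simp [Set.ncard_univ]

/-- This is the hypothesis of `trans_of_clean` that answers are no longer than queries. -/
theorem Valid.length_bits_satCount (hφ : φ.Valid) :
    φ.satCount.bits.length ≤ φ.encode.length := by
  have h₁ := hφ.n_le
  have h₂ := φ.length_encode_ge
  have h₃ : φ.satCount.bits.length ≤ φ.n + 1 :=
    length_bits_le_of_lt (φ.satCount_le.trans_lt (Nat.pow_lt_pow_right (by decide) (by omega)))
  omega

theorem Valid.length_bits_cutCount (hφ : φ.Valid) :
    (3 ^ φ.clauses.length * φ.satCount).bits.length ≤ 4 * φ.encode.length := by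
  have h₁ := hφ.n_le
  have h₂ := φ.length_encode_ge
  have h₃ : 3 ^ φ.clauses.length * φ.satCount < 2 ^ (2 * φ.clauses.length + φ.n + 1) :=
    calc 3 ^ φ.clauses.length * φ.satCount
        ≤ 4 ^ φ.clauses.length * 2 ^ φ.n :=
          Nat.mul_le_mul (Nat.pow_le_pow_left (by decide) _) φ.satCount_le
      _ = 2 ^ (2 * φ.clauses.length + φ.n) := by rw [pow_add, pow_mul]; norm_num
      _ < 2 ^ (2 * φ.clauses.length + φ.n + 1) := Nat.pow_lt_pow_right (by decide) (by omega)
  have h₄ := length_bits_le_of_lt h₃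
  omega

theorem encode_toMaxCut (φ : MonotoneFormula) :
    φ.toMaxCut.encode = buildOutput φ.n φ.pairs := by
  rw [GraphWithNumber.encode, edges_toMaxCut, buildOutput, List.length_map, add_right_comm]
  rfl

theorem Valid.size_bounds (hφ : φ.Valid) :
    φ.n + 8 * φ.pairs.length + 1 ≤ 4 * φ.encode.length ∧
      ∀ e ∈ φ.pairs, e.1 ≤ 4 * φ.encode.length ∧ e.2 ≤ 4 * φ.encode.length := by
  have h₁ := hφ.n_le
  have h₂ := φ.length_encode_ge
  rw [List.length_map]
  refine ⟨by omega, fun e he => ?_⟩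
  have := φ.pairs_lt he
  omega

end MonotoneFormula

/-! ### The construction and the reduction run in polynomial time. -/

theorem polyTimeComputable_toMaxCut :
    PolyTimeComputable (fun φ : {φ : MonotoneFormula // φ.Valid} => φ.1.encode)
      GraphWithNumber.encode (fun φ => φ.1.toMaxCut) := by
  refine ⟨build, 1000 * (4 * Polynomial.X + 1) ^ 3, fun φ => ?_⟩
  obtain ⟨h₁, h₂⟩ := φ.2.size_bounds
  obtain ⟨t, ht, e⟩ := build_run (O := noOracle) h₁ h₂
  rw [St.toStore_init] at e
  exact ⟨t, _, by simpa using ht, e, φ.1.encode_toMaxCut.symm⟩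

/-- Stronger than reducibility, since the whole final store is prescribed; this is what composition
with another reduction requires. -/
theorem exists_clean_reduction : ∃ (Q : Prog) (q : Polynomial ℕ),
    ∀ φ : sharpMonotone2SAT.Instance,
      Run sharpMaxCut.oracle Q (initStore (sharpMonotone2SAT.encode φ) [])
        (q.eval (sharpMonotone2SAT.encode φ).length)
        (initStore (sharpMonotone2SAT.count φ).bits []) := by
  refine ⟨reduce, 1100 * (4 * Polynomial.X + 1) ^ 3, fun φ => ?_⟩
  obtain ⟨h₁, h₂⟩ := φ.2.size_bounds
  have hO : sharpMaxCut.oracle (buildOutput φ.1.n φ.1.pairs)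
      (3 ^ φ.1.pairs.length * φ.1.satCount).bits := by
    refine ⟨⟨φ.1.toMaxCut, φ.2.toMaxCut_valid⟩, φ.1.encode_toMaxCut, ?_⟩
    rw [List.length_map, ← φ.2.cutCount_toMaxCut]
    rfl
  have h := reduce_run h₁ h₂ hO (by rw [List.length_map]; exact φ.2.length_bits_cutCount)
  refine Run.mono h ?_
  simp [sharpMonotone2SAT]

/-! ### Membership in #P -/

theorem witnessDefect_eq_zero {n : ℕ} {w : List Bool} :
    witnessDefect n w = 0 ↔
      (∀ i, n ≤ i → w.getD i false = false) ∧ w.getD 0 false = false := by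
  have h₁ : (w.headD false).toNat = 0 ↔ w.getD 0 false = false := by
    rcases w with _ | ⟨_ | _, w⟩ <;> simp
  have h₂ : (w.drop n).count true = 0 ↔ ∀ i, n ≤ i → w.getD i false = false := by
    rw [List.count_eq_zero]
    constructor
    · intro h i hi
      rcases lt_or_ge i w.length with hi' | hi'
      · rw [List.getD_eq_getElem _ _ hi']
        by_contra hw
        refine h (List.mem_iff_getElem.mpr ⟨i - n, by rw [List.length_drop]; omega, ?_⟩)
        rw [List.getElem_drop]
        simpa [show n + (i - n) = i by omega] using hw
      · exact List.getD_eq_default _ _ hi'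
    · intro h hm
      obtain ⟨j, hj, hj'⟩ := List.mem_iff_getElem.mp hm
      rw [List.length_drop] at hj
      rw [List.getElem_drop] at hj'
      have := h (n + j) (by omega)
      rw [List.getD_eq_getElem _ _ (by omega), hj'] at this
      exact absurd this (by decide)
  rw [witnessDefect, Nat.add_eq_zero_iff, h₁, h₂, and_comm]

namespace GraphWithNumber

variable {I : GraphWithNumber}

/-- Connectedness keeps the number of vertices linear in the length of the code, so a word of that
length has room for the colours of all vertices. -/
theorem Valid.n_le (hI : I.Valid) : I.n ≤ I.edges.length + 1 := by
  have h := hI.connected.card_vert_le_card_edgeSet_add_one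
  rw [Nat.card_eq_fintype_card, Fintype.card_fin] at h
  refine h.trans (Nat.add_le_add_right ?_ 1)
  have hinj : Function.Injective (Sym2.map (Fin.val : Fin I.n → ℕ)) :=
    Sym2.map.injective Fin.val_injective
  rw [Nat.card_coe_set_eq, ← Set.ncard_image_of_injective _ hinj]
  have hsub : Sym2.map (Fin.val : Fin I.n → ℕ) '' I.graph.edgeSet ⊆
      ↑(I.edges.map fun e => s(e.1, e.2)).toFinset := by
    rintro _ ⟨z, hz, rfl⟩
    induction z using Sym2.ind with
    | _ a b =>
      rw [SimpleGraph.mem_edgeSet, graph_adj hI.loopless] at hz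
      simp only [List.coe_toFinset, Set.mem_ofPred_eq, List.mem_map]
      rcases hz with hz | hz
      · exact ⟨_, hz, rfl⟩
      · exact ⟨_, hz, Sym2.eq_swap⟩
  refine (Set.ncard_le_ncard hsub (Finset.finite_toSet _)).trans ?_
  rw [Set.ncard_coe_finset]
  exact (List.toFinset_card_le _).trans (List.length_map _).le

/-- The witness is the canonical code of a two-colouring with the required number of crossing
edges. -/
def accepts (I : GraphWithNumber) (w : List Bool) : Bool :=
  decide (witnessDefect I.n w + mismatch (crossings (fun i => w.getD i false) I.edges).bits I.k.bits
    = 0)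

theorem accepts_iff {w : List Bool} :
    I.accepts w = true ↔ (∀ i, I.n ≤ i → w.getD i false = false) ∧ w.getD 0 false = false ∧
      crossings (fun i => w.getD i false) I.edges = I.k := by
  rw [accepts, decide_eq_true_iff, Nat.add_eq_zero_iff, witnessDefect_eq_zero, mismatch_eq_zero,
    natBits_injective.eq_iff, and_assoc]

/-- Each cut has exactly one accepted word: the colour `false` of vertex `0` decides which shore is
`true`, and the padding beyond the vertices is all `false`. -/
theorem Valid.cutCount_eq_ncard (hI : I.Valid) {L : ℕ} (hL : I.n ≤ L) :
    I.cutCount = {w : List Bool | w.length = L ∧ I.accepts w = true}.ncard := by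
  have hn : 0 < I.n := by
    obtain ⟨v⟩ := hI.connected.nonempty
    exact v.pos
  rw [cutCount_eq hI.vertices hI.loopless hI.nodup hI.pos hn]
  symm
  refine Set.ncard_congr (fun w _ i => w.getD i false) ?_ ?_ ?_
  · rintro w ⟨_, hw⟩
    exact accepts_iff.mp hw
  · rintro w w' ⟨hw, _⟩ ⟨hw', _⟩ h
    refine List.ext_getElem (hw.trans hw'.symm) fun i hi hi' => ?_
    have := congrFun h i
    rwa [List.getD_eq_getElem _ _ hi, List.getD_eq_getElem _ _ hi'] at this
  · rintro f hf
    -- Beyond `L` the default value `false` agrees with `f`, which vanishes from `I.n ≤ L` on.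
    have hget : (fun i => ((List.range L).map f).getD i false) = f := by
      funext i
      rcases lt_or_ge i L with hi | hi
      · rw [List.getD_eq_getElem _ _ (by simpa using hi)]
        simp
      · rw [List.getD_eq_default _ _ (by simpa using hi), hf.1 i (hL.trans hi)]
    refine ⟨(List.range L).map f, ⟨by simp, accepts_iff.mpr ?_⟩, hget⟩
    have h := congrFun hget
    simp only [h]
    exact hf

end GraphWithNumber

theorem inSharpP_sharpMaxCut : InSharpP sharpMaxCut := by
  refine ⟨verify, 200 * (Polynomial.X + 1) ^ 3, Polynomial.X, fun I w => I.1.accepts w,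
    fun I => ?_⟩
  have hn := I.2.n_le
  have hp := length_encodePairs_ge I.1.edges
  have hN := length_encodeNat_pos I.1.n
  have hlen : (sharpMaxCut.encode I).length = (encodeNat I.1.n).length +
      ((encodeNat I.1.k).length + (encodePairs I.1.edges).length) := by
    rw [← List.length_append, ← List.length_append]
    rfl
  have hk : I.1.k.bits.length ≤ (encodeNat I.1.k).length := by
    simp [encodeNat, List.length_flatMap]
    omega
  constructor
  · intro w hw
    rw [Polynomial.eval_X] at hw
    have hlw : ∀ c ∈ I.1.edges, c.1 < w.length ∧ c.2 < w.length := by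
      intro c hc
      have := I.2.vertices c hc
      omega
    obtain ⟨s, hs, t, ht, e⟩ := verify_run (O := noOracle) (n := I.1.n)
      (L := (sharpMaxCut.encode I).length) (k := I.1.k.bits) (w := w) (l := I.1.edges)
      (by omega) hw.le (by omega) (by omega) hlw
    exact ⟨t, s, by simpa using ht, e, hs⟩
  · rw [Polynomial.eval_X]
    exact I.2.cutCount_eq_ncard (by omega)

theorem mainTheorem2 :
    -- the construction yields instances of #Max Cut, with the stated number of solutions
    (∀ φ : MonotoneFormula, φ.Valid →
      φ.toMaxCut.Valid ∧ φ.toMaxCut.cutCount = 3 ^ φ.clauses.length * φ.satCount) ∧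
    -- it can be carried out in polynomial time
    PolyTimeComputable (fun φ : {φ : MonotoneFormula // φ.Valid} => φ.1.encode)
      GraphWithNumber.encode (fun φ => φ.1.toMaxCut) ∧
    -- #Monotone 2-SAT ∝ #Max Cut
    PolyTimeTuringReducible sharpMonotone2SAT sharpMaxCut ∧
    -- #Max Cut is in #P, and it is #P-complete as soon as #Monotone 2-SAT is #P-hard
    InSharpP sharpMaxCut ∧
    (SharpPHard sharpMonotone2SAT → SharpPComplete sharpMaxCut) := by
  refine ⟨fun φ hφ => ⟨hφ.toMaxCut_valid, hφ.cutCount_toMaxCut⟩, polyTimeComputable_toMaxCut, ?_,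
    inSharpP_sharpMaxCut, fun hard => ⟨inSharpP_sharpMaxCut, fun A hA => ?_⟩⟩
  · obtain ⟨Q, q, hQ⟩ := exists_clean_reduction
    refine ⟨Q, q, fun φ => ?_⟩
    obtain ⟨t, ht, e⟩ := hQ φ
    exact ⟨t, _, ht, e, rfl⟩
  · exact (hard A hA).trans_of_clean (fun φ => φ.2.length_bits_satCount) exists_clean_reduction
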